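/- Let $d\ge 1$ and let $\eta=(\eta^{\mu\nu})_{1\le\mu,\nu\le d}$ be a nondegenerate real symmetric matrix (for example the Minkowski metric). Let $\mathcal{H}^{\mathrm T}$ be the complex vector space of expressions that are formal power series in commuting variables $y^1,\dots,y^d$, polynomials in commuting variables $a^{\dagger 1},\dots,a^{\dagger d}$, and polynomials in the anticommuting variables $\theta,c^\dagger,\xi,b^\dagger,\mathcal{C}^1,\dots,\mathcal{C}^d$; that is, $\mathcal{H}^{\mathrm T}=\mathbb{C}[[y]][a^\dagger]\otimes\bigwedge(\theta,c^\dagger,\xi,b^\dagger,\mathcal{C}^\mu)$. Put $$\Box=\eta^{\mu\nu}\frac{\partial}{\partial y^\mu}\frac{\partial}{\partial y^\nu},\qquad S=\eta^{\mu\nu}\frac{\partial}{\partial a^{\dagger\mu}}\frac{\partial}{\partial y^\nu},\qquad T=\eta^{\mu\nu}\frac{\partial}{\partial a^{\dagger\mu}}\frac{\partial}{\partial a^{\dagger\nu}},$$ and let $\mathsf{\Omega}=\mathsf{\Omega}^{\mathrm T}_{-1}$ be the operator on $\mathcal{H}^{\mathrm T}$ determined by $$\imath\,\mathsf{\Omega}=-\imath\theta\Box+c^\dagger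 S+\imath\xi T ,$$ where $\theta,c^\dagger,\xi$ act by left multiplication. For $i\ge0$ let $\mathcal{H}_i\subset\mathcal{H}^{\mathrm T}$ be the subspace of elements homogeneous of total degree $i$ in $\theta,c^\dagger,\xi$, so that $\mathsf{\Omega}\mathcal{H}_i\subset\mathcal{H}_{i+1}$, and let $H_i=(\mathcal{H}_i\cap\ker\mathsf{\Omega})/\mathsf{\Omega}\mathcal{H}_{i-1}$ (with $\mathcal{H}_{-1}=0$). 1. If $d=1$ or $d=2$, then $H_0\ne0$, $H_1\neq0$, and $H_i=0$ for all $i\ge2$. 2. If $d\ge3$, then $H_0\neq0$ and $H_i=0$ for all $i\ge1$. Moreover, in both cases, every element $\Phi$ of the space $\hat{\mathcal{E}}$ of all $\Phi\in\mathcal{H}_0$ (i.e. $\Phi=\Phi(y,a^\dagger,b^\dagger,\mathcal{C})$) with $\Box\Phi=0$, $S\Phi=0$, $T\Phi=0$ is a cocycle, and sending $\Phi$ to its class is a linear isomorphism $\hat{\mathcal{E}}\to H_0$. -/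

import Mathlib

set_option maxSynthPendingDepth 3

noncomputable section

namespace Fronsdal

/-- The Grassmann-odd generators of the parent space: the target-space ghosts `θ`, `c†`, `ξ`,
`b†` and the space-time ghosts `C^μ`, `μ = 1, …, d`. -/
inductive Ghost (d : ℕ) : Type
  | theta : Ghost d
  | cDag : Ghost d
  | xi : Ghost d
  | bDag : Ghost d
  | C (μ : Fin d) : Ghost d
  deriving DecidableEq

/-- The position of a generator in the ordering `θ < c† < ξ < b† < C^1 < ⋯ < C^d`, used to write
ghost monomials. -/
def Ghost.rank {d : ℕ} : Ghost d → ℕ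
  | .theta => 0
  | .cDag => 1
  | .xi => 2
  | .bDag => 3
  | .C μ => 4 + μ

theorem Ghost.rank_injective {d : ℕ} : Function.Injective (Ghost.rank (d := d)) := by
  intro g h hgh
  cases g <;> cases h <;> simp only [Ghost.rank] at hgh <;> first
    | rfl
    | omega
    | (congr 1; apply Fin.ext; omega)

/-- `ℂ[[y]][a†]`: polynomials in the commuting variables `a†^1, …, a†^d` whose coefficients are
formal power series in the commuting variables `y^1, …, y^d`. -/
abbrev Coeff (d : ℕ) : Type := MvPolynomial (Fin d) (MvPowerSeries (Fin d) ℂ)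

/-- The parent space `H^T`: formal power series in `y`, polynomials in `a†` and in the
anticommuting ghosts. The element `Φ` stands for the sum over all finite sets `I` of ghosts of
`g_1 ⋯ g_k Φ_I(y, a†)`, where `g_1 < ⋯ < g_k` are the elements of `I`. -/
abbrev ParentSpace (d : ℕ) : Type := Finset (Ghost d) → Coeff d

/-- `∂/∂a†^μ`. -/
def dA {d : ℕ} (μ : Fin d) : Coeff d →ₗ[ℂ] Coeff d :=
  (MvPolynomial.pderiv (R := MvPowerSeries (Fin d) ℂ) μ).toLinearMap.restrictScalars ℂ

/-- `∂/∂y^μ`, acting on the power series that are the coefficients of a polynomial in `a†`. -/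
def dY {d : ℕ} (μ : Fin d) : Coeff d →ₗ[ℂ] Coeff d where
  toFun f := AddMonoidAlgebra.map
    (MvPowerSeries.pderiv ℂ μ : MvPowerSeries (Fin d) ℂ →ₗ[ℂ] MvPowerSeries (Fin d) ℂ).toAddMonoidHom f
  map_add' f g := AddMonoidAlgebra.map_add _ f g
  map_smul' c f := by
    ext m : 2
    simp

/-- `□ = η^{μν} ∂/∂y^μ ∂/∂y^ν`. -/
def box {d : ℕ} (η : Matrix (Fin d) (Fin d) ℝ) : ParentSpace d →ₗ[ℂ] ParentSpace d :=
  (∑ μ, ∑ ν, (η μ ν : ℂ) • (dY μ ∘ₗ dY ν)).compLeft (Finset (Ghost d))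

/-- `S = η^{μν} ∂/∂a†^μ ∂/∂y^ν`. -/
def opS {d : ℕ} (η : Matrix (Fin d) (Fin d) ℝ) : ParentSpace d →ₗ[ℂ] ParentSpace d :=
  (∑ μ, ∑ ν, (η μ ν : ℂ) • (dA μ ∘ₗ dY ν)).compLeft (Finset (Ghost d))

/-- `T = η^{μν} ∂/∂a†^μ ∂/∂a†^ν`. -/
def opT {d : ℕ} (η : Matrix (Fin d) (Fin d) ℝ) : ParentSpace d →ₗ[ℂ] ParentSpace d :=
  (∑ μ, ∑ ν, (η μ ν : ℂ) • (dA μ ∘ₗ dA ν)).compLeft (Finset (Ghost d))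

/-- Left multiplication by the ghost `g`. The product of `g` and the monomial of a set `J` not
containing `g` is the monomial of `J ∪ {g}` up to the sign `(-1)^k`, with `k` the number of
elements of `J` that precede `g`; it is zero if `J` contains `g`. -/
def ghostMul {d : ℕ} (g : Ghost d) : ParentSpace d →ₗ[ℂ] ParentSpace d where
  toFun Φ I := if g ∈ I then (-1 : ℂ) ^ (I.filter fun h => h.rank < g.rank).card • Φ (I.erase g)
    else 0
  map_add' Φ Ψ := by
    funext I
    by_cases h : g ∈ I <;> simp [h]
  map_smul' c Φ := by
    funext I
    by_cases h : g ∈ I <;> simp [h, smul_comm c]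

theorem ghostMul_self {d : ℕ} (g : Ghost d) (Φ : ParentSpace d) :
    ghostMul g (ghostMul g Φ) = 0 := by
  funext I
  simp [ghostMul]

theorem ghostMul_anticomm {d : ℕ} {g h : Ghost d} (hgh : g ≠ h) (Φ : ParentSpace d) :
    ghostMul g (ghostMul h Φ) = -ghostMul h (ghostMul g Φ) := by
  wlog hlt : g.rank < h.rank generalizing g h
  · have hlt' : h.rank < g.rank :=
      lt_of_le_of_ne (not_lt.mp hlt) fun e => hgh (Ghost.rank_injective e.symm)
    rw [this hgh.symm hlt', neg_neg]
  funext I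
  simp only [ghostMul, LinearMap.coe_mk, AddHom.coe_mk, Pi.neg_apply, Finset.mem_erase]
  by_cases hg : g ∈ I <;> by_cases hh : h ∈ I
  · have e1 : ((I.erase g).filter fun k => k.rank < h.rank) =
        (I.filter fun k => k.rank < h.rank).erase g := Finset.filter_erase _ _ _
    have e2 : ((I.erase h).filter fun k => k.rank < g.rank) =
        I.filter fun k => k.rank < g.rank := by
      rw [Finset.filter_erase]
      apply Finset.erase_eq_of_notMem
      simp only [Finset.mem_filter, not_and, not_lt]
      exact fun _ => hlt.le
    have e3 : (I.filter fun k => k.rank < h.rank).card =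
        ((I.filter fun k => k.rank < h.rank).erase g).card + 1 :=
      (Finset.card_erase_add_one (by simp [hg, hlt])).symm
    simp only [hg, hh, hgh, hgh.symm, e1, e2, e3, ne_eq, not_false_eq_true, and_self, if_true,
      Finset.erase_right_comm (a := h) (b := g), smul_smul, pow_succ]
    rw [← neg_smul]
    congr 1
    ring
  all_goals simp [hg, hh]

/-- `Ω^T_{-1}`, where `i Ω^T_{-1} = -i θ □ + c† S + i ξ T`. -/
def omega {d : ℕ} (η : Matrix (Fin d) (Fin d) ℝ) : ParentSpace d →ₗ[ℂ] ParentSpace d :=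
  (-Complex.I) • (-(Complex.I • (ghostMul .theta ∘ₗ box η)) + ghostMul .cDag ∘ₗ opS η
    + Complex.I • (ghostMul .xi ∘ₗ opT η))

/-- The elements of `H^T` that are homogeneous of degree `i` in `θ`, `c†`, `ξ`. -/
def homogeneous (d i : ℕ) : Submodule ℂ (ParentSpace d) where
  carrier := {Φ | ∀ I : Finset (Ghost d), (I ∩ {.theta, .cDag, .xi}).card ≠ i → Φ I = 0}
  add_mem' hΦ hΨ I hI := by simp [hΦ I hI, hΨ I hI]
  zero_mem' _ _ := rfl
  smul_mem' c Φ hΦ I hI := by simp [hΦ I hI]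

/-- The cocycles of `Ω^T_{-1}` in degree `i`. -/
def cocycles {d : ℕ} (η : Matrix (Fin d) (Fin d) ℝ) (i : ℕ) : Submodule ℂ (ParentSpace d) :=
  homogeneous d i ⊓ LinearMap.ker (omega η)

/-- The coboundaries of `Ω^T_{-1}` in degree `i`; the degrees start at `0`. -/
def coboundaries {d : ℕ} (η : Matrix (Fin d) (Fin d) ℝ) : ℕ → Submodule ℂ (ParentSpace d)
  | 0 => ⊥
  | i + 1 => (homogeneous d i).map (omega η)

/-- The cohomology `H_i(Ω^T_{-1}, H^T)`: cocycles modulo coboundaries in degree `i`. -/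
abbrev Cohomology {d : ℕ} (η : Matrix (Fin d) (Fin d) ℝ) (i : ℕ) : Type :=
  cocycles η i ⧸ (coboundaries η i).submoduleOf (cocycles η i)

/-- The space `Ê` of the elements `Φ(y, a†, b†, C)` of `H^T`, i.e. those that do not involve
`θ`, `c†`, `ξ`, with `□ Φ = 0`, `S Φ = 0`, `T Φ = 0`. -/
def hatE {d : ℕ} (η : Matrix (Fin d) (Fin d) ℝ) : Submodule ℂ (ParentSpace d) :=
  homogeneous d 0 ⊓ LinearMap.ker (box η) ⊓ LinearMap.ker (opS η) ⊓ LinearMap.ker (opT η)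

end Fronsdal

end

/-!
On the components of `Φ` along the ghost monomials, `Ω` is the Koszul differential of the three
commuting operators `□`, `S`, `T` on `ℂ[[y]][a†]`, with the ghosts `b†` and `C^μ` as spectators.
The cohomology in degree `0` is therefore the joint kernel of the operators, and everything else
follows from diagram chases once three solvability statements are available:

* `boxCoeff_surjective`: `□` is surjective;
* `exists_tCoeff_eq`: `T` is surjective on the kernel of `□`;
* `exists_sCoeff_eq`: for `d ≥ 3`, `S` is surjective on the common kernel of `□` and `T`.

The first two give vanishing in all degrees `≥ 2` and, together with the third, in degree `1`.

The solvability statements are dual to regularity of a sequence of polynomials. A formal power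
series is a functional on polynomials, and under this duality (`pairing`) the operators become
multiplication by their symbols `η^{μν} p_μ p_ν`, `η^{μν} α_μ α_ν`, `η^{μν} α_μ p_ν`. If a symbol
`q` is not a zero divisor modulo an ideal `I`, then functionals vanishing on `I` extend along
multiplication by `q` (`exists_pairing_eq_of_regular`). The symbols of `□` and `T` involve disjoint
variables, so they are relatively prime. For `d ≥ 3`, a nondegenerate quadratic form is prime over
every domain containing `ℂ` (`prime_quadric`), being `2 u v + c` in suitable coordinates with `c`
nonzero and independent of `u` and `v`. Hence the symbols of `□` and `T` generate a prime ideal,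
and the symbol of `S`, having degree one in `α`, is regular modulo it
(`mem_span_of_sSymbol_mul_mem_span`).

For `d = 1, 2` the quadratic form `η` splits into linear forms, one of them `k`. The polynomial
`k(α) k(p)` times the symbol of `S` then lies in the ideal generated by the symbols of `□` and `T`,
so it pairs to zero with `S f` for all `f` annihilated by `□` and `T`. But it does not pair to zero
with all of `y^μ a†^μ`, and `c† y^μ a†^μ` is a nontrivial cocycle (`nontrivial_cohomology_one`).
-/

noncomputable section

namespace Fronsdal

/-! ### Primality of nondegenerate quadratic forms -/

open MvPolynomial in
/-- The quadratic form `H^{μν} x_μ x_ν` as a polynomial over a `ℂ`-algebra `A`. -/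
def quadric {n : ℕ} (A : Type*) [CommRing A] [Algebra ℂ A] (H : Matrix (Fin n) (Fin n) ℂ) :
    MvPolynomial (Fin n) A :=
  ∑ μ, ∑ ν, H μ ν • (X μ * X ν)

/-- A linear polynomial `u x + c` over a domain is prime if `u` is prime and does not divide `c`:
the quotient embeds into the localization at `u`, where `x = -c / u`. The domain need not have
unique factorization, so irreducibility would not be enough. -/
theorem prime_linear {B : Type*} [CommRing B] [IsDomain B] {u c : B} (hu : Prime u)
    (hc : ¬ u ∣ c) : Prime (Polynomial.C u * Polynomial.X + Polynomial.C c : Polynomial B) := by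
  classical
  set l : Polynomial B := Polynomial.C u * Polynomial.X + Polynomial.C c with hl
  have huK : algebraMap B (FractionRing B) u ≠ 0 := by
    simpa using hu.ne_zero
  -- evaluation at the root `-c / u` of the linear polynomial
  let ψ : Polynomial B →ₐ[B] FractionRing B :=
    Polynomial.aeval (-(algebraMap B (FractionRing B) c) / algebraMap B (FractionRing B) u)
  have hψl : ψ l = 0 := by
    simp only [ψ, hl, map_add, map_mul, Polynomial.aeval_C, Polynomial.aeval_X]
    field_simp
    ring
  have hdiv : ∀ F : Polynomial B, ∃ (n : ℕ) (G : Polynomial B) (r : B),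
      Polynomial.C (u ^ n) * F = G * l + Polynomial.C r := by
    intro F
    induction F using Polynomial.induction_on' with
    | add p q hp hq =>
      obtain ⟨n, G, r, h⟩ := hp
      obtain ⟨m, G', r', h'⟩ := hq
      refine ⟨n + m, Polynomial.C (u ^ m) * G + Polynomial.C (u ^ n) * G',
        u ^ m * r + u ^ n * r', ?_⟩
      simp only [map_add, map_mul, map_pow] at *
      linear_combination (Polynomial.C u) ^ m * h + (Polynomial.C u) ^ n * h'
    | monomial k a =>
      induction k generalizing a with
      | zero => exact ⟨0, 0, a, by simp⟩
      | succ k ih =>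
        obtain ⟨n, G, r, h⟩ := ih a
        refine ⟨n + 1, Polynomial.C u * Polynomial.X * G + Polynomial.C r, -(r * c), ?_⟩
        rw [← Polynomial.monomial_mul_X]
        simp only [map_mul, map_neg, map_pow, hl] at *
        linear_combination Polynomial.C u * Polynomial.X * h
  have hCu : Prime (Polynomial.C u) := Polynomial.prime_C_iff.2 hu
  have hul : ¬ Polynomial.C u ∣ l := fun h => hc <| by
    simpa [hl] using (Polynomial.C_dvd_iff_dvd_coeff _ _).1 h 0
  have hcancel : ∀ (n : ℕ) (F G : Polynomial B), Polynomial.C (u ^ n) * F = G * l → l ∣ F := by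
    intro n
    induction n with
    | zero => intro F G h; exact ⟨G, by simpa [mul_comm] using h⟩
    | succ n ih =>
      intro F G h
      have : Polynomial.C u ∣ G * l := ⟨Polynomial.C (u ^ n) * F, by
        rw [← h, pow_succ', map_mul, mul_assoc]⟩
      obtain ⟨G', rfl⟩ := (hCu.dvd_or_dvd this).resolve_right hul
      refine ih F G' (mul_left_cancel₀ hCu.ne_zero ?_)
      rw [← mul_assoc, ← mul_assoc, ← h, pow_succ', map_mul]
  have hker : ∀ F, ψ F = 0 → l ∣ F := by
    intro F hF
    obtain ⟨n, G, r, h⟩ := hdiv F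
    have hr : r = 0 := by
      have := congrArg ψ h
      simpa [hF, hψl, ψ] using this.symm
    exact hcancel n F G (by simpa [hr] using h)
  refine ⟨?_, ?_, ?_⟩
  · intro h0
    exact hul (h0 ▸ dvd_zero _)
  · intro h
    exact not_isUnit_zero (hψl ▸ h.map ψ)
  · rintro a b ⟨t, ht⟩
    have : ψ a * ψ b = 0 := by rw [← map_mul, ht, map_mul, hψl, zero_mul]
    exact (mul_eq_zero.1 this).imp (hker a) (hker b)

section Substitution

open MvPolynomial

variable {n : ℕ} (A : Type*) [CommRing A] [Algebra ℂ A]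

/-- The linear substitution `x_i ↦ ∑_j P_{ij} x_j`. -/
def linSubst (P : Matrix (Fin n) (Fin n) ℂ) : MvPolynomial (Fin n) A →ₐ[A] MvPolynomial (Fin n) A :=
  aeval fun i => ∑ j, P i j • X j

theorem linSubst_smul_X (P : Matrix (Fin n) (Fin n) ℂ) (z : ℂ) (i : Fin n) :
    linSubst A P (z • X i) = z • ∑ j, P i j • X j := by
  rw [← algebraMap_smul A z (X i), map_smul, algebraMap_smul]
  simp [linSubst]

theorem linSubst_comp (P Q : Matrix (Fin n) (Fin n) ℂ) :
    (linSubst A P).comp (linSubst A Q) = linSubst A (Q * P) := by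
  refine algHom_ext fun i => ?_
  have h : linSubst A Q (X i) = ∑ j, Q i j • X j := by simp [linSubst]
  have h' : linSubst A (Q * P) (X i) = ∑ j, (Q * P) i j • X j := by simp [linSubst]
  rw [AlgHom.comp_apply, h, h', map_sum]
  simp only [linSubst_smul_X, Finset.smul_sum, Matrix.mul_apply, Finset.sum_smul, mul_smul]
  exact Finset.sum_comm

theorem linSubst_one : linSubst A (1 : Matrix (Fin n) (Fin n) ℂ) = AlgHom.id A _ := by
  refine algHom_ext fun i => ?_
  simp [linSubst, Matrix.one_apply, ite_smul]

/-- A linear substitution acts on quadratic forms by congruence. -/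
theorem linSubst_quadric (P H : Matrix (Fin n) (Fin n) ℂ) :
    linSubst A P (quadric A H) = quadric A (P.transpose * H * P) := by
  have hX : ∀ i, linSubst A P (X i) = ∑ j, P i j • X j := fun i => by simp [linSubst]
  have hsm : ∀ (z : ℂ) x, linSubst A P (z • x) = z • linSubst A P x := fun z x => by
    rw [← algebraMap_smul A z x, map_smul, algebraMap_smul]
  have hl : linSubst A P (quadric A H) =
      ∑ a, ∑ b, ∑ i, ∑ j, (P a i * H a b * P b j) • (X i * X j : MvPolynomial (Fin n) A) := by
    simp only [quadric, map_sum, hsm, map_mul, hX]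
    refine Finset.sum_congr rfl fun a _ => Finset.sum_congr rfl fun b _ => ?_
    rw [Finset.sum_mul_sum]
    simp only [Finset.smul_sum, smul_mul_smul_comm, smul_smul]
    refine Finset.sum_congr rfl fun i _ => Finset.sum_congr rfl fun j _ => ?_
    congr 1
    ring
  have hr : quadric A (P.transpose * H * P) =
      ∑ i, ∑ j, ∑ b, ∑ a, (P a i * H a b * P b j) • (X i * X j : MvPolynomial (Fin n) A) := by
    simp only [quadric, Matrix.mul_apply, Finset.sum_smul, Matrix.transpose_apply, Finset.sum_mul]
  rw [hl, hr, Finset.sum_comm]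
  calc _ = ∑ b, ∑ i, ∑ j, ∑ a, (P a i * H a b * P b j) • (X i * X j : MvPolynomial (Fin n) A) := by
        refine Finset.sum_congr rfl fun b _ => ?_
        rw [Finset.sum_comm]
        exact Finset.sum_congr rfl fun i _ => Finset.sum_comm
    _ = _ := by
        rw [Finset.sum_comm]
        exact Finset.sum_congr rfl fun i _ => Finset.sum_comm

/-- The linear substitution by an invertible matrix is an automorphism. -/
def linSubstEquiv (P Q : Matrix (Fin n) (Fin n) ℂ) (hPQ : P * Q = 1) (hQP : Q * P = 1) :
    MvPolynomial (Fin n) A ≃ₐ[A] MvPolynomial (Fin n) A :=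
  AlgEquiv.ofAlgHom (linSubst A P) (linSubst A Q)
    (by rw [linSubst_comp, hQP, linSubst_one]) (by rw [linSubst_comp, hPQ, linSubst_one])

end Substitution

/-- Nondegenerate symmetric matrices over `ℂ` are congruent. -/
theorem exists_congr_of_isSymm {n : ℕ} (H G : Matrix (Fin n) (Fin n) ℂ) (hH : H.IsSymm)
    (hG : G.IsSymm) (hH' : IsUnit H.det) (hG' : IsUnit G.det) :
    ∃ P : Matrix (Fin n) (Fin n) ℂ, IsUnit P ∧ P.transpose * H * P = G := by
  have key : ∀ M : Matrix (Fin n) (Fin n) ℂ, M.IsSymm →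
      QuadraticMap.associated (R := ℂ) M.toQuadraticForm' = Matrix.toLinearMap₂' ℂ M := by
    intro M hM
    refine QuadraticMap.associated_left_inverse _ ?_
    intro x y
    rw [Matrix.toLinearMap₂'_apply', Matrix.toLinearMap₂'_apply', Matrix.dotProduct_mulVec,
      ← Matrix.mulVec_transpose, hM.eq, dotProduct_comm]
  have sep : ∀ M : Matrix (Fin n) (Fin n) ℂ, M.IsSymm → IsUnit M.det →
      (QuadraticMap.associated (R := ℂ) M.toQuadraticForm').SeparatingLeft := by
    intro M hM hM'
    rw [key M hM]
    exact (Matrix.nondegenerate_of_det_ne_zero hM'.ne_zero).toLinearMap₂' |>.1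
  obtain ⟨e⟩ := QuadraticForm.equivalent_of_isAlgClosed _ _ (sep G hG hG') (sep H hH hH')
  have hcomp : G.toQuadraticForm' = H.toQuadraticForm'.comp e.toLinearEquiv.toLinearMap := by
    ext x
    exact (e.map_app x).symm
  have hm : ∀ M : Matrix (Fin n) (Fin n) ℂ, M.IsSymm → M.toQuadraticForm'.toMatrix' = M := by
    intro M hM
    rw [QuadraticForm.toMatrix', key M hM]
    simp
  refine ⟨LinearMap.toMatrix' e.toLinearEquiv.toLinearMap, ?_, ?_⟩
  · exact (Matrix.isUnit_iff_isUnit_det _).2 (by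
      rw [LinearMap.det_toMatrix']
      exact e.toLinearEquiv.isUnit_det')
  · have := congrArg QuadraticForm.toMatrix' hcomp
    rw [QuadraticForm.toMatrix'_comp, hm H hH, hm G hG] at this
    exact this.symm

open MvPolynomial in
/-- The quadratic form `2 x_0 x_1 + ∑_{i ≥ 2} x_i^2` in at least three variables is prime, as a
linear polynomial in `x_0`. -/
theorem prime_quadric_swap (n : ℕ) (A : Type*) [CommRing A] [IsDomain A] [Algebra ℂ A] :
    Prime (quadric A ((Equiv.swap (0 : Fin (n + 3)) 1).permMatrix ℂ)) := by
  have h2 : IsUnit (2 : MvPolynomial (Fin (n + 2)) A) := by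
    have : IsUnit (algebraMap ℂ (MvPolynomial (Fin (n + 2)) A) 2) :=
      (IsUnit.mk0 (2 : ℂ) two_ne_zero).map _
    rwa [map_ofNat] at this
  have hu : Prime (2 * X 0 : MvPolynomial (Fin (n + 2)) A) :=
    (Associated.prime_iff (associated_unit_mul_left _ _ h2)).2 (X_prime)
  have hc : ¬ (2 * X 0 : MvPolynomial (Fin (n + 2)) A) ∣
      ∑ i : Fin (n + 1), X i.succ * X i.succ := by
    intro h
    have := map_dvd (eval (fun j : Fin (n + 2) => if j = 1 then (1 : A) else 0)) h
    have h1 : ∀ x : Fin (n + 1), x.succ = 1 ↔ x = 0 := fun x => by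
      rw [← Fin.succ_zero_eq_one, Fin.succ_inj]
    simp [h1] at this
  rw [← MulEquiv.prime_iff (finSuccEquiv A (n + 2)).toMulEquiv]
  convert prime_linear hu hc using 1
  have hs : ∀ i : Fin (n + 1), Equiv.swap (0 : Fin (n + 3)) 1 i.succ.succ = i.succ.succ := fun i =>
    Equiv.swap_apply_of_ne_of_ne (Fin.succ_ne_zero _)
      fun h => Fin.succ_ne_zero i (Fin.succ_injective _ h)
  have : quadric A ((Equiv.swap (0 : Fin (n + 3)) 1).permMatrix ℂ)
      = ∑ i, X i * X (Equiv.swap (0 : Fin (n + 3)) 1 i) := by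
    simp [quadric, Equiv.Perm.permMatrix, PEquiv.toMatrix_apply, ite_smul]
  have h10 : (1 : Fin (n + 3)) = Fin.succ 0 := rfl
  rw [this, Fin.sum_univ_succ, Fin.sum_univ_succ]
  simp only [hs, Fin.succ_zero_eq_one, Equiv.swap_apply_left, Equiv.swap_apply_right]
  change finSuccEquiv A (n + 2) _ = _
  simp only [map_add, map_mul, map_sum, finSuccEquiv_X_zero, finSuccEquiv_X_succ, h10, map_ofNat]
  ring

/-- A nondegenerate complex quadratic form in at least three variables is prime over every domain
containing `ℂ`. -/
theorem prime_quadric {d : ℕ} (hd : 3 ≤ d) (A : Type*) [CommRing A] [IsDomain A] [Algebra ℂ A]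
    (H : Matrix (Fin d) (Fin d) ℂ) (hH : H.IsSymm) (hdet : IsUnit H.det) :
    Prime (quadric A H) := by
  obtain ⟨n, rfl⟩ := Nat.exists_eq_add_of_le' hd
  have hG : ((Equiv.swap (0 : Fin (n + 3)) 1).permMatrix ℂ).IsSymm := by
    simp [Matrix.IsSymm, Matrix.transpose_permMatrix]
  have hG' : IsUnit ((Equiv.swap (0 : Fin (n + 3)) 1).permMatrix ℂ).det := by
    rw [Matrix.det_permutation]
    simp
  obtain ⟨P, ⟨Q, rfl⟩, h⟩ := exists_congr_of_isSymm H _ hH hG hdet hG'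
  rw [← MulEquiv.prime_iff (linSubstEquiv A Q.1 Q.2 Q.3 Q.4).toMulEquiv]
  have : (linSubstEquiv A Q.1 Q.2 Q.3 Q.4) (quadric A H) = _ := linSubst_quadric A Q.1 H
  convert prime_quadric_swap n A using 1
  rw [← h]
  exact this

/-! ### Regularity of the symbols of `□`, `T`, `S` -/

section Symbols

open MvPolynomial

theorem map_quadric {n : ℕ} {A B : Type*} [CommRing A] [Algebra ℂ A] [CommRing B] [Algebra ℂ B]
    (f : A →ₐ[ℂ] B) (H : Matrix (Fin n) (Fin n) ℂ) :
    map (f : A →+* B) (quadric A H) = quadric B H := by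
  simp only [quadric, map_sum]
  refine Finset.sum_congr rfl fun a _ => Finset.sum_congr rfl fun b _ => ?_
  rw [Algebra.smul_def, Algebra.smul_def,
    IsScalarTower.algebraMap_apply ℂ A (MvPolynomial (Fin n) A),
    IsScalarTower.algebraMap_apply ℂ B (MvPolynomial (Fin n) B)]
  simp [algebraMap_eq]

theorem quadric_complex_ne_zero {n : ℕ} {H : Matrix (Fin n) (Fin n) ℂ} (hH : H.IsSymm)
    (h0 : H ≠ 0) : quadric ℂ H ≠ 0 := by
  intro h
  have hev : ∀ v : Fin n → ℂ, ∑ i, ∑ j, H i j * (v i * v j) = 0 := by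
    intro v
    simpa [quadric, smul_eval] using congrArg (eval v) h
  have hbil : ∀ v w : Fin n → ℂ, ∑ i, ∑ j, H i j * (v i * w j) = 0 := by
    intro v w
    have hsw : ∑ i, ∑ j, H i j * (w i * v j) = ∑ i, ∑ j, H i j * (v i * w j) := by
      rw [Finset.sum_comm]
      refine Finset.sum_congr rfl fun i _ => Finset.sum_congr rfl fun j _ => ?_
      rw [hH.apply]
      ring
    have h1 := hev (v + w)
    simp only [Pi.add_apply, mul_add, add_mul, Finset.sum_add_distrib, hev, hsw] at h1
    linear_combination h1 / 2
  apply h0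
  ext i j
  simpa [Pi.single_apply] using hbil (Pi.single i 1) (Pi.single j 1)

theorem exists_isUnit_coeff_quadric {n : ℕ} (A : Type*) [CommRing A] [Algebra ℂ A]
    {H : Matrix (Fin n) (Fin n) ℂ} (hH : H.IsSymm) (h0 : H ≠ 0) :
    ∃ m, IsUnit (coeff m (quadric A H)) := by
  obtain ⟨m, hm⟩ := ne_zero_iff.1 (quadric_complex_ne_zero hH h0)
  refine ⟨m, ?_⟩
  rw [← map_quadric (Algebra.ofId ℂ A) H, coeff_map]
  exact (IsUnit.mk0 _ hm).map _

theorem quadric_ne_zero {n : ℕ} (A : Type*) [CommRing A] [Nontrivial A] [Algebra ℂ A]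
    {H : Matrix (Fin n) (Fin n) ℂ} (hH : H.IsSymm) (h0 : H ≠ 0) : quadric A H ≠ 0 := by
  obtain ⟨m, hm⟩ := exists_isUnit_coeff_quadric A hH h0
  intro h
  simp [h] at hm

theorem totalDegree_quadric {n : ℕ} (A : Type*) [CommRing A] [Nontrivial A] [Algebra ℂ A]
    {H : Matrix (Fin n) (Fin n) ℂ} (hH : H.IsSymm) (h0 : H ≠ 0) :
    (quadric A H).totalDegree = 2 := by
  refine IsHomogeneous.totalDegree ?_ (quadric_ne_zero A hH h0)
  refine IsHomogeneous.sum _ _ _ fun i _ => IsHomogeneous.sum _ _ _ fun j _ => ?_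
  rw [Algebra.smul_def, IsScalarTower.algebraMap_apply ℂ A (MvPolynomial (Fin n) A)]
  exact ((isHomogeneous_X A i).mul (isHomogeneous_X A j)).C_mul _

theorem eq_zero_of_quadric_dvd {n : ℕ} {A : Type*} [CommRing A] [IsDomain A] [Algebra ℂ A]
    {H : Matrix (Fin n) (Fin n) ℂ} (hH : H.IsSymm) (h0 : H ≠ 0) {f : MvPolynomial (Fin n) A}
    (hf : f.totalDegree ≤ 1) (h : quadric A H ∣ f) : f = 0 := by
  obtain ⟨g, rfl⟩ := h
  by_contra hne
  rw [totalDegree_mul_of_isDomain (left_ne_zero_of_mul hne) (right_ne_zero_of_mul hne),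
    totalDegree_quadric A hH h0] at hf
  omega

/-- The polynomials in the symbols of the derivatives: the inner variables `p_μ` stand for
`∂/∂y^μ`, the outer variables `α_μ` for `∂/∂a†^μ`. -/
abbrev SymbolRing (d : ℕ) : Type := MvPolynomial (Fin d) (MvPolynomial (Fin d) ℂ)

/-- The symbol of `□`. -/
def boxSymbol {d : ℕ} (H : Matrix (Fin d) (Fin d) ℂ) : SymbolRing d :=
  ∑ μ, ∑ ν, H μ ν • (C (X μ) * C (X ν))

/-- The symbol of `S`. -/
def sSymbol {d : ℕ} (H : Matrix (Fin d) (Fin d) ℂ) : SymbolRing d :=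
  ∑ μ, ∑ ν, H μ ν • (X μ * C (X ν))

/-- The symbol of `T`. -/
def tSymbol {d : ℕ} (H : Matrix (Fin d) (Fin d) ℂ) : SymbolRing d :=
  ∑ μ, ∑ ν, H μ ν • (X μ * X ν)

variable {d : ℕ} {H : Matrix (Fin d) (Fin d) ℂ}

theorem C_complex_smul (z : ℂ) (r : MvPolynomial (Fin d) ℂ) :
    (C (z • r) : SymbolRing d) = z • C r := by
  ext m : 1
  rw [coeff_smul, coeff_C, coeff_C]
  split_ifs <;> simp

theorem boxSymbol_eq_C : boxSymbol H = C (quadric ℂ H) := by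
  simp only [boxSymbol, quadric, map_sum, C_complex_smul, map_mul]

theorem boxSymbol_ne_zero (hH : H.IsSymm) (h0 : H ≠ 0) : boxSymbol H ≠ 0 := by
  rw [boxSymbol_eq_C]
  simpa using quadric_complex_ne_zero hH h0

/-- The symbols of `□` and `T` involve disjoint sets of variables, hence have no common factor. -/
theorem isRelPrime_boxSymbol_tSymbol (hH : H.IsSymm) (h0 : H ≠ 0) :
    IsRelPrime (boxSymbol H) (tSymbol H) := by
  rintro e ⟨e', he'⟩ he
  have hne : e * e' ≠ 0 := he' ▸ boxSymbol_ne_zero hH h0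
  have hdeg : e.totalDegree = 0 := by
    have h := congrArg totalDegree he'
    rw [boxSymbol_eq_C, totalDegree_C, totalDegree_mul_of_isDomain (left_ne_zero_of_mul hne)
      (right_ne_zero_of_mul hne)] at h
    omega
  obtain ⟨m, hm⟩ := exists_isUnit_coeff_quadric (MvPolynomial (Fin d) ℂ) hH h0
  rw [totalDegree_eq_zero_iff_eq_C.1 hdeg] at he ⊢
  exact (isUnit_of_dvd_unit ((C_dvd_iff_dvd_coeff _ _).1 he m) hm).map _

/-- The symbol of `T` is not a zero divisor modulo the symbol of `□`. -/
theorem boxSymbol_dvd_of_dvd_tSymbol_mul (hH : H.IsSymm) (h0 : H ≠ 0) {x : SymbolRing d}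
    (h : boxSymbol H ∣ tSymbol H * x) : boxSymbol H ∣ x :=
  (isRelPrime_boxSymbol_tSymbol hH h0).dvd_of_dvd_mul_left h

/-- For `d ≥ 3` the symbol of `S` is not a zero divisor modulo the symbols of `□` and `T`. The
quotient by the symbol of `□` is a polynomial ring over a domain, in which the symbol of `T` is
prime of degree `2` and the symbol of `S` is nonzero of degree `1`. -/
theorem mem_span_of_sSymbol_mul_mem_span (hd : 3 ≤ d) (hH : H.IsSymm) (hdet : IsUnit H.det)
    {x : SymbolRing d} (hx : sSymbol H * x ∈ Ideal.span {boxSymbol H, tSymbol H}) :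
    x ∈ Ideal.span {boxSymbol H, tSymbol H} := by
  have h0 : H ≠ 0 := by
    rintro rfl
    have : Nonempty (Fin d) := ⟨⟨0, by omega⟩⟩
    simp at hdet
  let q := quadric ℂ H
  have hq : Prime q := prime_quadric hd ℂ H hH hdet
  let A := MvPolynomial (Fin d) ℂ ⧸ Ideal.span {q}
  have : (Ideal.span {q}).IsPrime := (Ideal.span_singleton_prime hq.ne_zero).2 hq
  let π : MvPolynomial (Fin d) ℂ →ₐ[ℂ] A := Ideal.Quotient.mkₐ ℂ _
  have hπ : ∀ r, π r = 0 ↔ q ∣ r := fun r => by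
    rw [← Ideal.mem_span_singleton]
    exact Ideal.Quotient.eq_zero_iff_mem
  let F : SymbolRing d →+* MvPolynomial (Fin d) A := map (π : MvPolynomial (Fin d) ℂ →+* A)
  have hFsurj : Function.Surjective F := map_surjective _ Ideal.Quotient.mk_surjective
  have hF : ∀ y, F y = 0 ↔ boxSymbol H ∣ y := by
    intro y
    rw [boxSymbol_eq_C, C_dvd_iff_dvd_coeff, MvPolynomial.ext_iff]
    refine forall_congr' fun m => ?_
    rw [← hπ, coeff_map, coeff_zero]
    rfl
  have hFt : F (tSymbol H) = quadric A H := map_quadric π H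
  have hFs : F (sSymbol H) = ∑ μ, C (π (∑ ν, H μ ν • X ν)) * X μ := by
    simp only [sSymbol, map_sum, Finset.sum_mul]
    refine Finset.sum_congr rfl fun a _ => Finset.sum_congr rfl fun b _ => ?_
    have : (H a b • (X a * C (X b)) : SymbolRing d) = C (H a b • X b) * X a := by
      rw [C_complex_smul, smul_mul_assoc, mul_comm]
    rw [this]
    simp [F]
  have hFs0 : F (sSymbol H) ≠ 0 := by
    intro h
    apply h0
    ext μ ν
    have hμ := congrArg (coeff (Finsupp.single μ 1)) h
    rw [hFs, coeff_sum] at hμ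
    simp only [coeff_C_mul, coeff_X, Finsupp.single_left_inj one_ne_zero, mul_ite, mul_one,
      mul_zero, Finset.sum_ite_eq', Finset.mem_univ, if_true, coeff_zero] at hμ
    have hl := eq_zero_of_quadric_dvd hH h0 ?_ ((hπ _).1 hμ)
    · have := congrArg (coeff (Finsupp.single ν 1)) hl
      simpa [coeff_sum, coeff_X, Finsupp.single_left_inj] using this
    · refine totalDegree_finsetSum_le fun i _ => ?_
      exact (totalDegree_smul_le _ _).trans (totalDegree_X _).le
  have hFsdeg : (F (sSymbol H)).totalDegree ≤ 1 := by
    rw [hFs]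
    refine totalDegree_finsetSum_le fun i _ => ?_
    refine (totalDegree_mul _ _).trans ?_
    rw [totalDegree_C, totalDegree_X]
  obtain ⟨z, w, hzw⟩ := Ideal.mem_span_pair.1 hx
  have hFz : F (boxSymbol H) = 0 := (hF _).2 dvd_rfl
  have hdvd : quadric A H ∣ F (sSymbol H) * F x := by
    refine ⟨F w, ?_⟩
    rw [← map_mul, ← hzw, map_add, map_mul, map_mul, hFz, hFt]
    ring
  rcases (prime_quadric hd A H hH hdet).dvd_or_dvd hdvd with h | ⟨g, hg⟩
  · exact absurd (eq_zero_of_quadric_dvd hH h0 hFsdeg h) hFs0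
  · obtain ⟨g, rfl⟩ := hFsurj g
    obtain ⟨k, hk⟩ := (hF (x - tSymbol H * g)).1 (by rw [map_sub, map_mul, hFt, hg, sub_self])
    exact Ideal.mem_span_pair.2 ⟨k, g, by linear_combination -hk⟩

end Symbols

/-! ### Duality between power series and symbols -/

section Duality

open MvPolynomial

variable {d : ℕ}

/-- The monomial basis of the ring of symbols, indexed by the exponents in `p` and in `α`. -/
def symbolBasis (d : ℕ) : Module.Basis ((Fin d →₀ ℕ) × (Fin d →₀ ℕ)) ℂ (SymbolRing d) :=
  (basisMonomials (Fin d) ℂ).smulTower (basisMonomials (Fin d) (MvPolynomial (Fin d) ℂ))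

theorem symbolBasis_apply (m n : Fin d →₀ ℕ) :
    symbolBasis d (m, n) = monomial n (monomial m 1) := by
  rw [symbolBasis, Module.Basis.smulTower_apply]
  simp [smul_monomial]

theorem C_X_mul_symbolBasis (μ : Fin d) (m n : Fin d →₀ ℕ) :
    C (X μ) * symbolBasis d (m, n) = symbolBasis d (m + Finsupp.single μ 1, n) := by
  rw [symbolBasis_apply, symbolBasis_apply, C_mul_monomial, mul_comm, X, monomial_mul, one_mul]

theorem X_mul_symbolBasis (μ : Fin d) (m n : Fin d →₀ ℕ) :
    X μ * symbolBasis d (m, n) = symbolBasis d (m, n + Finsupp.single μ 1) := by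
  rw [symbolBasis_apply, symbolBasis_apply, mul_comm, X, monomial_mul, mul_one]

/-- The factorial `∏_i m_i!` of an exponent. -/
def expFactorial (m : Fin d →₀ ℕ) : ℕ := ∏ i, (m i).factorial

theorem expFactorial_ne_zero (m : Fin d →₀ ℕ) : expFactorial m ≠ 0 := by
  rw [expFactorial, Finset.prod_ne_zero_iff]
  exact fun i _ => Nat.factorial_ne_zero _

theorem expFactorial_add_single (m : Fin d →₀ ℕ) (μ : Fin d) :
    expFactorial (m + Finsupp.single μ 1) = expFactorial m * (m μ + 1) := by
  rw [expFactorial, expFactorial, ← Finset.mul_prod_erase _ _ (Finset.mem_univ μ),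
    ← Finset.mul_prod_erase _ (fun i => (m i).factorial) (Finset.mem_univ μ)]
  have : ∀ i ∈ Finset.univ.erase μ,
      ((m + Finsupp.single μ 1 : Fin d →₀ ℕ) i).factorial = (m i).factorial := fun i hi => by
    simp [Finsupp.single_eq_of_ne (Finset.ne_of_mem_erase hi)]
  rw [Finset.prod_congr rfl this]
  simp only [Finsupp.add_apply, Finsupp.single_eq_same, Nat.factorial_succ]
  ring

theorem coeff_dY (μ : Fin d) (f : Coeff d) (n : Fin d →₀ ℕ) :
    coeff n (dY μ f) = MvPowerSeries.pderiv ℂ μ (coeff n f) := by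
  simp [dY, coeff]

theorem coeff_dA (μ : Fin d) (f : Coeff d) (n : Fin d →₀ ℕ) :
    coeff n (dA μ f) = coeff (n + Finsupp.single μ 1) f * (n μ + 1) :=
  coeff_pderiv _ _

/-- The pairing between `ℂ[[y]][a†]` and the ring of symbols: a symbol acts as a differential
operator with constant coefficients, and the result is evaluated at `y = a† = 0`. -/
def pairing (d : ℕ) : Coeff d →ₗ[ℂ] Module.Dual ℂ (SymbolRing d) :=
  ((symbolBasis d).constr ℂ).toLinearMap ∘ₗ
    { toFun := fun f mn =>
        (expFactorial mn.1 * expFactorial mn.2 : ℂ) * MvPowerSeries.coeff mn.1 (coeff mn.2 f)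
      map_add' := fun f g => by
        funext mn
        simp [mul_add]
      map_smul' := fun z f => by
        funext mn
        simp
        ring }

theorem pairing_symbolBasis (f : Coeff d) (m n : Fin d →₀ ℕ) :
    pairing d f (symbolBasis d (m, n)) =
      expFactorial m * expFactorial n * MvPowerSeries.coeff m (coeff n f) := by
  simp [pairing, Module.Basis.constr_basis]

theorem pairing_injective : Function.Injective (pairing d) := by
  rw [injective_iff_map_eq_zero]
  intro f hf
  ext n m
  have := pairing_symbolBasis f m n
  rw [hf] at this
  simpa [expFactorial_ne_zero] using this.symm

theorem pairing_dY (μ : Fin d) (f : Coeff d) (x : SymbolRing d) :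
    pairing d (dY μ f) x = pairing d f (C (X μ) * x) := by
  have : pairing d (dY μ f) = pairing d f ∘ₗ LinearMap.mulLeft ℂ (C (X μ)) := by
    refine (symbolBasis d).ext ?_
    rintro ⟨m, n⟩
    rw [LinearMap.comp_apply, LinearMap.mulLeft_apply, C_X_mul_symbolBasis, pairing_symbolBasis,
      pairing_symbolBasis, coeff_dY, MvPowerSeries.coeff_pderiv, expFactorial_add_single]
    push_cast
    ring
  rw [this]
  rfl

theorem pairing_dA (μ : Fin d) (f : Coeff d) (x : SymbolRing d) :
    pairing d (dA μ f) x = pairing d f (X μ * x) := by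
  have : pairing d (dA μ f) = pairing d f ∘ₗ LinearMap.mulLeft ℂ (X μ) := by
    refine (symbolBasis d).ext ?_
    rintro ⟨m, n⟩
    rw [LinearMap.comp_apply, LinearMap.mulLeft_apply, X_mul_symbolBasis, pairing_symbolBasis,
      pairing_symbolBasis, coeff_dA, expFactorial_add_single]
    have : ((n μ : MvPowerSeries (Fin d) ℂ) + 1) = MvPowerSeries.C (n μ + 1 : ℂ) := by simp
    rw [this, MvPowerSeries.coeff_mul_C]
    push_cast
    ring
  rw [this]
  rfl

/-- The projection of the ring of symbols onto the part of degree at most `K` in `α`. -/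
def symbolTrunc (K : ℕ) : SymbolRing d →ₗ[ℂ] SymbolRing d :=
  (symbolBasis d).constr ℂ fun mn => if mn.2.degree ≤ K then symbolBasis d mn else 0

theorem symbolTrunc_symbolBasis (K : ℕ) (m n : Fin d →₀ ℕ) :
    symbolTrunc K (symbolBasis d (m, n)) = if n.degree ≤ K then symbolBasis d (m, n) else 0 := by
  simp [symbolTrunc, Module.Basis.constr_basis]

theorem symbolTrunc_C_X_mul (K : ℕ) (μ : Fin d) (x : SymbolRing d) :
    symbolTrunc K (C (X μ) * x) = C (X μ) * symbolTrunc K x := by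
  have : symbolTrunc K ∘ₗ LinearMap.mulLeft ℂ (C (X μ)) =
      LinearMap.mulLeft ℂ (C (X μ)) ∘ₗ symbolTrunc (d := d) K := by
    refine (symbolBasis d).ext ?_
    rintro ⟨m, n⟩
    simp only [LinearMap.comp_apply, LinearMap.mulLeft_apply, C_X_mul_symbolBasis,
      symbolTrunc_symbolBasis]
    split_ifs <;> simp [C_X_mul_symbolBasis]
  exact LinearMap.congr_fun this x

theorem symbolTrunc_X_mul (K : ℕ) (μ : Fin d) (x : SymbolRing d) :
    symbolTrunc (K + 1) (X μ * x) = X μ * symbolTrunc K x := by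
  have : symbolTrunc (K + 1) ∘ₗ LinearMap.mulLeft ℂ (X μ) =
      LinearMap.mulLeft ℂ (X μ) ∘ₗ symbolTrunc (d := d) K := by
    refine (symbolBasis d).ext ?_
    rintro ⟨m, n⟩
    simp only [LinearMap.comp_apply, LinearMap.mulLeft_apply, X_mul_symbolBasis,
      symbolTrunc_symbolBasis, map_add, Finsupp.degree_single, add_le_add_iff_right]
    split_ifs <;> simp [X_mul_symbolBasis]
  exact LinearMap.congr_fun this x

/-- A functional on the ring of symbols, cut off beyond degree `K` in `α`, comes from an element
of `ℂ[[y]][a†]`. The cutoff is needed because elements of `ℂ[[y]][a†]` are polynomial in `a†`. -/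
theorem exists_pairing_eq_comp_symbolTrunc (g : Module.Dual ℂ (SymbolRing d)) (K : ℕ) :
    ∃ f : Coeff d, ∀ x, pairing d f x = g (symbolTrunc K x) := by
  have hfin : {n : Fin d →₀ ℕ | n.degree ≤ K}.Finite := Finsupp.finite_of_degree_le K
  let F : (Fin d →₀ ℕ) → MvPowerSeries (Fin d) ℂ := fun n m =>
    (expFactorial m * expFactorial n : ℂ)⁻¹ * g (symbolBasis d (m, n))
  refine ⟨∑ n ∈ hfin.toFinset, monomial n (F n), fun x => ?_⟩
  have hc : ∀ n, coeff n (∑ n ∈ hfin.toFinset, monomial n (F n)) =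
      if n.degree ≤ K then F n else 0 := fun n => by
    simp [coeff_sum, coeff_monomial]
  change _ = (g ∘ₗ symbolTrunc K) x
  congr 1
  refine (symbolBasis d).ext ?_
  rintro ⟨m, n⟩
  rw [pairing_symbolBasis, hc, LinearMap.comp_apply, symbolTrunc_symbolBasis]
  split_ifs
  · change _ * ((expFactorial m * expFactorial n : ℂ)⁻¹ * g (symbolBasis d (m, n))) = _
    rw [mul_inv_cancel_left₀]
    exact mul_ne_zero (Nat.cast_ne_zero.2 (expFactorial_ne_zero _))
      (Nat.cast_ne_zero.2 (expFactorial_ne_zero _))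
  · simp

/-- Each `f` in `ℂ[[y]][a†]` is polynomial in `a†`, so its pairing ignores high degrees in `α`. -/
theorem exists_pairing_symbolTrunc_eq (f : Coeff d) :
    ∃ N, ∀ K, N ≤ K → ∀ x, pairing d f (symbolTrunc K x) = pairing d f x := by
  refine ⟨f.totalDegree, fun K hK x => ?_⟩
  change (pairing d f ∘ₗ symbolTrunc K) x = _
  congr 1
  refine (symbolBasis d).ext ?_
  rintro ⟨m, n⟩
  rw [LinearMap.comp_apply, symbolTrunc_symbolBasis]
  split_ifs with h
  · rfl
  · have : coeff n f = 0 := by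
      apply coeff_eq_zero_of_totalDegree_lt
      rw [← Finsupp.degree_apply]
      omega
    rw [pairing_symbolBasis, this]
    simp

/-- Solvability of `Q f' = f` for an operator `Q` with symbol `q`: if `q` is not a zero divisor
modulo an ideal `I` of symbols, then `Q` is surjective on the space annihilated by `I`. Indeed a
functional on `SymbolRing d / I` extends along the injective multiplication by `q`. The
hypotheses on `symbolTrunc` say that `I` and `q` are homogeneous in `α`, `q` of degree `e`. -/
theorem exists_pairing_eq_of_regular {I : Ideal (SymbolRing d)} {q : SymbolRing d} {e : ℕ}
    (he : e ≤ 2) (hI : ∀ K x, x ∈ I → symbolTrunc (K + 2) x ∈ I)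
    (hq : ∀ K x, symbolTrunc (K + e) (q * x) = q * symbolTrunc K x)
    (hreg : ∀ x, q * x ∈ I → x ∈ I) (f : Coeff d) (hf : ∀ x ∈ I, pairing d f x = 0) :
    ∃ f' : Coeff d, (∀ x ∈ I, pairing d f' x = 0) ∧
      ∀ x, pairing d f' (q * x) = pairing d f x := by
  let J : Submodule ℂ (SymbolRing d) := I.restrictScalars ℂ
  let L : SymbolRing d ⧸ J →ₗ[ℂ] SymbolRing d ⧸ J :=
    J.mapQ J (LinearMap.mulLeft ℂ q) fun x hx => I.mul_mem_left q hx
  have hL : Function.Injective L := by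
    rw [injective_iff_map_eq_zero]
    intro x
    induction x using Submodule.Quotient.induction_on with
    | _ x =>
      intro hx
      have hx' : (Submodule.Quotient.mk (q * x) : SymbolRing d ⧸ J) = 0 := hx
      rw [Submodule.Quotient.mk_eq_zero] at hx'
      exact (Submodule.Quotient.mk_eq_zero _).2 (hreg x hx')
  obtain ⟨g, hg⟩ := LinearMap.dualMap_surjective_of_injective hL (J.liftQ (pairing d f) hf)
  have hg' : ∀ x, g (Submodule.Quotient.mk (q * x)) = pairing d f x := fun x =>
    LinearMap.congr_fun hg (Submodule.Quotient.mk x)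
  obtain ⟨N, hN⟩ := exists_pairing_symbolTrunc_eq f
  obtain ⟨f', hf'⟩ := exists_pairing_eq_comp_symbolTrunc (g ∘ₗ J.mkQ) (N + 2)
  refine ⟨f', fun x hx => ?_, fun x => ?_⟩
  · rw [hf', LinearMap.comp_apply, Submodule.mkQ_apply,
      (Submodule.Quotient.mk_eq_zero J).2 (hI N x hx), map_zero]
  · have : N + 2 = (N + (2 - e)) + e := by omega
    rw [hf', this, hq, LinearMap.comp_apply, Submodule.mkQ_apply, hg', hN _ (by omega)]

end Duality

/-! ### The operators on coefficients and their solvability -/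

section Operators

variable {d : ℕ} (η : Matrix (Fin d) (Fin d) ℝ)

/-- The operator `□` on `ℂ[[y]][a†]`. -/
def boxCoeff : Coeff d →ₗ[ℂ] Coeff d := ∑ μ, ∑ ν, (η μ ν : ℂ) • (dY μ ∘ₗ dY ν)

/-- The operator `S` on `ℂ[[y]][a†]`. -/
def sCoeff : Coeff d →ₗ[ℂ] Coeff d := ∑ μ, ∑ ν, (η μ ν : ℂ) • (dA μ ∘ₗ dY ν)

/-- The operator `T` on `ℂ[[y]][a†]`. -/
def tCoeff : Coeff d →ₗ[ℂ] Coeff d := ∑ μ, ∑ ν, (η μ ν : ℂ) • (dA μ ∘ₗ dA ν)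

/-- The matrix `η` with complex entries. -/
abbrev complexMetric : Matrix (Fin d) (Fin d) ℂ := η.map Complex.ofReal

theorem pairing_boxCoeff (f : Coeff d) (x : SymbolRing d) :
    pairing d (boxCoeff η f) x = pairing d f (boxSymbol (complexMetric η) * x) := by
  simp only [boxCoeff, boxSymbol, LinearMap.sum_apply, LinearMap.smul_apply, LinearMap.comp_apply,
    map_sum, map_smul, pairing_dY, Finset.sum_mul, smul_mul_assoc, Matrix.map_apply]
  refine Finset.sum_congr rfl fun a _ => Finset.sum_congr rfl fun b _ => ?_
  rw [mul_left_comm, mul_assoc]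

theorem pairing_sCoeff (f : Coeff d) (x : SymbolRing d) :
    pairing d (sCoeff η f) x = pairing d f (sSymbol (complexMetric η) * x) := by
  simp only [sCoeff, sSymbol, LinearMap.sum_apply, LinearMap.smul_apply, LinearMap.comp_apply,
    map_sum, map_smul, pairing_dY, pairing_dA, Finset.sum_mul, smul_mul_assoc, Matrix.map_apply]
  refine Finset.sum_congr rfl fun a _ => Finset.sum_congr rfl fun b _ => ?_
  rw [mul_left_comm, mul_assoc]

theorem pairing_tCoeff (f : Coeff d) (x : SymbolRing d) :
    pairing d (tCoeff η f) x = pairing d f (tSymbol (complexMetric η) * x) := by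
  simp only [tCoeff, tSymbol, LinearMap.sum_apply, LinearMap.smul_apply, LinearMap.comp_apply,
    map_sum, map_smul, pairing_dA, Finset.sum_mul, smul_mul_assoc, Matrix.map_apply]
  refine Finset.sum_congr rfl fun a _ => Finset.sum_congr rfl fun b _ => ?_
  rw [mul_left_comm, mul_assoc]

theorem symbolTrunc_boxSymbol_mul (H : Matrix (Fin d) (Fin d) ℂ) (K : ℕ) (x : SymbolRing d) :
    symbolTrunc K (boxSymbol H * x) = boxSymbol H * symbolTrunc K x := by
  simp only [boxSymbol, Finset.sum_mul, map_sum, smul_mul_assoc, map_smul, mul_assoc,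
    symbolTrunc_C_X_mul]

theorem symbolTrunc_sSymbol_mul (H : Matrix (Fin d) (Fin d) ℂ) (K : ℕ) (x : SymbolRing d) :
    symbolTrunc (K + 1) (sSymbol H * x) = sSymbol H * symbolTrunc K x := by
  simp only [sSymbol, Finset.sum_mul, map_sum, smul_mul_assoc, map_smul, mul_assoc,
    symbolTrunc_C_X_mul, symbolTrunc_X_mul]

theorem symbolTrunc_tSymbol_mul (H : Matrix (Fin d) (Fin d) ℂ) (K : ℕ) (x : SymbolRing d) :
    symbolTrunc (K + 2) (tSymbol H * x) = tSymbol H * symbolTrunc K x := by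
  simp only [tSymbol, Finset.sum_mul, map_sum, smul_mul_assoc, map_smul, mul_assoc,
    symbolTrunc_X_mul]

theorem pairing_comm_of {P Q : Coeff d →ₗ[ℂ] Coeff d} {p q : SymbolRing d}
    (hP : ∀ f x, pairing d (P f) x = pairing d f (p * x))
    (hQ : ∀ f x, pairing d (Q f) x = pairing d f (q * x)) (f : Coeff d) : P (Q f) = Q (P f) := by
  refine pairing_injective (LinearMap.ext fun x => ?_)
  rw [hP, hQ, hQ, hP, mul_left_comm]

theorem sCoeff_boxCoeff (f : Coeff d) : sCoeff η (boxCoeff η f) = boxCoeff η (sCoeff η f) :=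
  pairing_comm_of (pairing_sCoeff η) (pairing_boxCoeff η) f

theorem tCoeff_boxCoeff (f : Coeff d) : tCoeff η (boxCoeff η f) = boxCoeff η (tCoeff η f) :=
  pairing_comm_of (pairing_tCoeff η) (pairing_boxCoeff η) f

theorem sCoeff_tCoeff (f : Coeff d) : sCoeff η (tCoeff η f) = tCoeff η (sCoeff η f) :=
  pairing_comm_of (pairing_sCoeff η) (pairing_tCoeff η) f

theorem eq_zero_iff_pairing {P : Coeff d →ₗ[ℂ] Coeff d} {p : SymbolRing d}
    (hP : ∀ f x, pairing d (P f) x = pairing d f (p * x)) (f : Coeff d) :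
    P f = 0 ↔ ∀ x, pairing d f (p * x) = 0 := by
  rw [← (map_eq_zero_iff (pairing d) pairing_injective), LinearMap.ext_iff]
  simp [hP]

theorem eq_iff_pairing {P : Coeff d →ₗ[ℂ] Coeff d} {p : SymbolRing d}
    (hP : ∀ f x, pairing d (P f) x = pairing d f (p * x)) (f f' : Coeff d) :
    P f' = f ↔ ∀ x, pairing d f' (p * x) = pairing d f x := by
  rw [← pairing_injective.eq_iff, LinearMap.ext_iff]
  simp [hP]

variable {η}

theorem isSymm_complexMetric (hη : η.IsSymm) : (complexMetric η).IsSymm := hη.map _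

theorem complexMetric_ne_zero (h0 : η ≠ 0) : complexMetric η ≠ 0 := by
  intro h
  apply h0
  ext i j
  simpa using congrFun (congrFun h i) j

theorem boxCoeff_surjective (hη : η.IsSymm) (h0 : η ≠ 0) : Function.Surjective (boxCoeff η) := by
  intro f
  have hne := boxSymbol_ne_zero (isSymm_complexMetric hη) (complexMetric_ne_zero h0)
  obtain ⟨f', -, h⟩ := exists_pairing_eq_of_regular (I := ⊥)
    (q := boxSymbol (complexMetric η)) (e := 0) (by omega) (by simp)
    (fun K x => symbolTrunc_boxSymbol_mul _ K x) (by simp [hne]) f (by simp)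
  exact ⟨f', (eq_iff_pairing (pairing_boxCoeff η) _ _).2 h⟩

theorem exists_tCoeff_eq (hη : η.IsSymm) (h0 : η ≠ 0) (f : Coeff d) (hf : boxCoeff η f = 0) :
    ∃ f', boxCoeff η f' = 0 ∧ tCoeff η f' = f := by
  rw [eq_zero_iff_pairing (pairing_boxCoeff η)] at hf
  have hI : ∀ K x, x ∈ Ideal.span {boxSymbol (complexMetric η)} →
      symbolTrunc (K + 2) x ∈ Ideal.span {boxSymbol (complexMetric η)} := by
    intro K x hx
    obtain ⟨z, rfl⟩ := Ideal.mem_span_singleton.1 hx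
    rw [symbolTrunc_boxSymbol_mul]
    exact Ideal.mem_span_singleton.2 (dvd_mul_right _ _)
  have hreg : ∀ x, tSymbol (complexMetric η) * x ∈ Ideal.span {boxSymbol (complexMetric η)} →
      x ∈ Ideal.span {boxSymbol (complexMetric η)} := by
    intro x hx
    rw [Ideal.mem_span_singleton] at hx ⊢
    exact boxSymbol_dvd_of_dvd_tSymbol_mul (isSymm_complexMetric hη) (complexMetric_ne_zero h0) hx
  have hann : ∀ x ∈ Ideal.span {boxSymbol (complexMetric η)}, pairing d f x = 0 := by
    intro x hx
    obtain ⟨z, rfl⟩ := Ideal.mem_span_singleton.1 hx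
    exact hf z
  obtain ⟨f', h', h⟩ := exists_pairing_eq_of_regular le_rfl hI
    (fun K x => symbolTrunc_tSymbol_mul _ K x) hreg f hann
  refine ⟨f', (eq_zero_iff_pairing (pairing_boxCoeff η) _).2 fun x => h' _ ?_,
    (eq_iff_pairing (pairing_tCoeff η) _ _).2 h⟩
  exact Ideal.mem_span_singleton.2 (dvd_mul_right _ _)

theorem exists_sCoeff_eq (hd : 3 ≤ d) (hη : η.IsSymm) (hdet : IsUnit η.det) (f : Coeff d)
    (hf : boxCoeff η f = 0) (hf' : tCoeff η f = 0) :
    ∃ f', boxCoeff η f' = 0 ∧ tCoeff η f' = 0 ∧ sCoeff η f' = f := by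
  have hdet' : IsUnit (complexMetric η).det := by
    have := hdet.map Complex.ofRealHom
    rwa [RingHom.map_det] at this
  rw [eq_zero_iff_pairing (pairing_boxCoeff η)] at hf
  rw [eq_zero_iff_pairing (pairing_tCoeff η)] at hf'
  have hI : ∀ K x, x ∈ Ideal.span {boxSymbol (complexMetric η), tSymbol (complexMetric η)} →
      symbolTrunc (K + 2) x ∈
        Ideal.span {boxSymbol (complexMetric η), tSymbol (complexMetric η)} := by
    intro K x hx
    obtain ⟨a, b, rfl⟩ := Ideal.mem_span_pair.1 hx
    rw [mul_comm a, mul_comm b, map_add, symbolTrunc_boxSymbol_mul, symbolTrunc_tSymbol_mul]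
    exact Ideal.mem_span_pair.2 ⟨symbolTrunc (K + 2) a, symbolTrunc K b, by ring⟩
  have hann : ∀ x ∈ Ideal.span {boxSymbol (complexMetric η), tSymbol (complexMetric η)},
      pairing d f x = 0 := by
    intro x hx
    obtain ⟨a, b, rfl⟩ := Ideal.mem_span_pair.1 hx
    rw [mul_comm a, mul_comm b, map_add, hf, hf', add_zero]
  obtain ⟨f', h', h⟩ := exists_pairing_eq_of_regular one_le_two hI
    (fun K x => symbolTrunc_sSymbol_mul _ K x)
    (fun x hx => mem_span_of_sSymbol_mul_mem_span hd (isSymm_complexMetric hη) hdet' hx) f hann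
  refine ⟨f', (eq_zero_iff_pairing (pairing_boxCoeff η) _).2 fun x => h' _ ?_,
    (eq_zero_iff_pairing (pairing_tCoeff η) _).2 fun x => h' _ ?_,
    (eq_iff_pairing (pairing_sCoeff η) _ _).2 h⟩
  · exact Ideal.mul_mem_right _ _ (Ideal.subset_span (by simp))
  · exact Ideal.mul_mem_right _ _ (Ideal.subset_span (by simp))

end Operators

/-! ### Exactness of the Koszul complex -/

section Koszul

variable {M : Type*} [AddCommGroup M] [Module ℂ M]

/-- The sign picked up on passing a Grassmann-odd generator, if it is present. -/
def ghostSign (t : Bool) : ℂ := if t then -1 else 1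

/-- The Koszul differential `θ A + c† C + ξ B`. The three Booleans record which of `θ`, `c†`, `ξ`
occur in a ghost monomial. -/
def koszul (A C B : M →ₗ[ℂ] M) (G : Bool → Bool → Bool → M) (t c x : Bool) : M :=
  (if t then A (G false c x) else 0) + (if c then ghostSign t • C (G t false x) else 0)
    + (if x then (ghostSign t * ghostSign c) • B (G t c false) else 0)

/-- Homogeneity of degree `i` in `θ`, `c†`, `ξ`. -/
def IsGhostHomogeneous (i : ℕ) (G : Bool → Bool → Bool → M) : Prop :=
  ∀ t c x : Bool, t.toNat + c.toNat + x.toNat ≠ i → G t c x = 0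

variable {A C B : M →ₗ[ℂ] M}

/-- In top degree exactness needs only surjectivity of `A`. -/
theorem koszul_exact_three (hA : Function.Surjective A) {G : Bool → Bool → Bool → M}
    (hG : IsGhostHomogeneous 3 G) :
    ∃ G', IsGhostHomogeneous 2 G' ∧ koszul A C B G' = G := by
  obtain ⟨f, hf⟩ := hA (G true true true)
  refine ⟨fun t c x => if !t && c && x then f else 0, ?_, ?_⟩
  · intro t c x h
    cases t <;> cases c <;> cases x <;> simp at h ⊢
  · funext t c x
    have := hG t c x
    cases t <;> cases c <;> cases x <;> simp_all [koszul]

/-- Exactness in degree two needs surjectivity of `A`, and of `B` on `ker A`; nothing is required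
of `C`. -/
theorem koszul_exact_two (hA : Function.Surjective A) (hCA : ∀ f, C (A f) = A (C f))
    (hBA : ∀ f, B (A f) = A (B f)) (hB : ∀ f, A f = 0 → ∃ f', A f' = 0 ∧ B f' = f)
    {G : Bool → Bool → Bool → M} (hG : IsGhostHomogeneous 2 G) (hD : koszul A C B G = 0) :
    ∃ G', IsGhostHomogeneous 1 G' ∧ koszul A C B G' = G := by
  obtain ⟨f₁, h₁⟩ := hA (G true true false)
  obtain ⟨f₂, h₂⟩ := hA (G true false true)
  have h3 : A (G false true true) - C (G true false true) + B (G true true false) = 0 := by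
    simpa [koszul, ghostSign, sub_eq_add_neg] using congrFun (congrFun (congrFun hD true) true) true
  obtain ⟨f₃, h₃, h₃'⟩ := hB (C f₂ - B f₁ - G false true true) (by
    rw [map_sub, map_sub, ← hCA, ← hBA, h₁, h₂, ← neg_eq_zero, ← h3]
    abel)
  refine ⟨fun t c x => bif t then 0 else bif c then (bif x then 0 else f₁ + f₃) else
    bif x then f₂ else 0, ?_, ?_⟩
  · intro t c x h
    cases t <;> cases c <;> cases x <;> simp at h ⊢
  · funext t c x
    have := hG t c x
    cases t <;> cases c <;> cases x <;> simp_all [koszul, ghostSign]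
    abel

/-- Exactness in degree one also needs surjectivity of `C` on `ker A ⊓ ker B`. The primitive is
corrected successively so as to match the `θ`, `ξ` and `c†` components. -/
theorem koszul_exact_one (hA : Function.Surjective A) (hCA : ∀ f, C (A f) = A (C f))
    (hBA : ∀ f, B (A f) = A (B f)) (hCB : ∀ f, C (B f) = B (C f))
    (hB : ∀ f, A f = 0 → ∃ f', A f' = 0 ∧ B f' = f)
    (hC : ∀ f, A f = 0 → B f = 0 → ∃ f', A f' = 0 ∧ B f' = 0 ∧ C f' = f)
    {G : Bool → Bool → Bool → M} (hG : IsGhostHomogeneous 1 G) (hD : koszul A C B G = 0) :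
    ∃ G', IsGhostHomogeneous 0 G' ∧ koszul A C B G' = G := by
  have htc : A (G false true false) = C (G true false false) := by
    have := congrFun (congrFun (congrFun hD true) true) false
    simpa [koszul, ghostSign, ← sub_eq_add_neg, sub_eq_zero] using this
  have htx : A (G false false true) = B (G true false false) := by
    have := congrFun (congrFun (congrFun hD true) false) true
    simpa [koszul, ghostSign, ← sub_eq_add_neg, sub_eq_zero] using this
  have hcx : C (G false false true) = B (G false true false) := by
    have := congrFun (congrFun (congrFun hD false) true) true
    simpa [koszul, ghostSign, ← sub_eq_add_neg, sub_eq_zero] using this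
  obtain ⟨f₁, h₁⟩ := hA (G true false false)
  obtain ⟨f₂, h₂, h₂'⟩ := hB (G false false true - B f₁) (by
    rw [map_sub, ← hBA, h₁, htx, sub_self])
  have hB12 : B (f₁ + f₂) = G false false true := by
    rw [map_add, h₂', add_sub_cancel]
  have hA12 : A (f₁ + f₂) = G true false false := by
    rw [map_add, h₂, h₁, add_zero]
  obtain ⟨f₃, h₃, h₃', h₃''⟩ := hC (G false true false - C (f₁ + f₂))
    (by rw [map_sub, ← hCA, hA12, htc, sub_self]) (by rw [map_sub, ← hCB, hB12, hcx, sub_self])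
  have hA' : A (f₁ + f₂ + f₃) = G true false false := by rw [map_add, h₃, hA12, add_zero]
  have hB' : B (f₁ + f₂ + f₃) = G false false true := by rw [map_add, h₃', hB12, add_zero]
  have hC' : C (f₁ + f₂ + f₃) = G false true false := by rw [map_add, h₃'', add_sub_cancel]
  refine ⟨fun t c x => if t || c || x then 0 else f₁ + f₂ + f₃, ?_, ?_⟩
  · intro t c x h
    cases t <;> cases c <;> cases x <;> simp at h ⊢
  · funext t c x
    have := hG t c x
    cases t <;> cases c <;> cases x <;> simp_all [koszul, ghostSign, -map_add]

end Koszul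

/-! ### Components along ghost monomials -/

section Components

variable {d : ℕ}

/-- `J` contains none of the ghosts `θ`, `c†`, `ξ`. -/
def IsSpectator (J : Finset (Ghost d)) : Prop := .theta ∉ J ∧ .cDag ∉ J ∧ .xi ∉ J

/-- The set `J` together with those of `θ`, `c†`, `ξ` that are selected by the Booleans. -/
def withGhosts (J : Finset (Ghost d)) (t c x : Bool) : Finset (Ghost d) :=
  J ∪ ((if t then {.theta} else ∅) ∪ ((if c then {.cDag} else ∅) ∪ (if x then {.xi} else ∅)))

theorem mem_withGhosts {J : Finset (Ghost d)} {t c x : Bool} {g : Ghost d} :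
    g ∈ withGhosts J t c x ↔
      g ∈ J ∨ (t = true ∧ g = .theta) ∨ (c = true ∧ g = .cDag) ∨ (x = true ∧ g = .xi) := by
  cases t <;> cases c <;> cases x <;> simp [withGhosts] <;> tauto

/-- The ghosts of `I` other than `θ`, `c†`, `ξ`. -/
def spectators (I : Finset (Ghost d)) : Finset (Ghost d) := I \ {.theta, .cDag, .xi}

theorem isSpectator_spectators (I : Finset (Ghost d)) : IsSpectator (spectators I) := by
  simp [IsSpectator, spectators]

theorem withGhosts_spectators (I : Finset (Ghost d)) :
    withGhosts (spectators I) (decide (.theta ∈ I)) (decide (.cDag ∈ I)) (decide (.xi ∈ I)) =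
      I := by
  ext g
  rw [mem_withGhosts, spectators]
  cases g <;> simp

theorem exists_eq_withGhosts (I : Finset (Ghost d)) :
    ∃ J t c x, IsSpectator J ∧ I = withGhosts J t c x :=
  ⟨_, _, _, _, isSpectator_spectators I, (withGhosts_spectators I).symm⟩

variable {J : Finset (Ghost d)}

theorem spectators_withGhosts (hJ : IsSpectator J) (t c x : Bool) :
    spectators (withGhosts J t c x) = J := by
  ext g
  obtain ⟨h1, h2, h3⟩ := hJ
  rw [spectators, Finset.mem_sdiff, mem_withGhosts]
  cases g <;> simp [h1, h2, h3]

theorem theta_mem_withGhosts (hJ : IsSpectator J) (t c x : Bool) :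
    .theta ∈ withGhosts J t c x ↔ t = true := by
  simp [mem_withGhosts, hJ.1]

theorem cDag_mem_withGhosts (hJ : IsSpectator J) (t c x : Bool) :
    .cDag ∈ withGhosts J t c x ↔ c = true := by
  simp [mem_withGhosts, hJ.2.1]

theorem xi_mem_withGhosts (hJ : IsSpectator J) (t c x : Bool) :
    .xi ∈ withGhosts J t c x ↔ x = true := by
  simp [mem_withGhosts, hJ.2.2]

theorem erase_theta_withGhosts (hJ : IsSpectator J) (t c x : Bool) :
    (withGhosts J t c x).erase .theta = withGhosts J false c x := by
  ext g
  rw [Finset.mem_erase, mem_withGhosts, mem_withGhosts]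
  cases g <;> simp [hJ.1]

theorem erase_cDag_withGhosts (hJ : IsSpectator J) (t c x : Bool) :
    (withGhosts J t c x).erase .cDag = withGhosts J t false x := by
  ext g
  rw [Finset.mem_erase, mem_withGhosts, mem_withGhosts]
  cases g <;> simp [hJ.2.1]

theorem erase_xi_withGhosts (hJ : IsSpectator J) (t c x : Bool) :
    (withGhosts J t c x).erase .xi = withGhosts J t c false := by
  ext g
  rw [Finset.mem_erase, mem_withGhosts, mem_withGhosts]
  cases g <;> simp [hJ.2.2]

theorem card_withGhosts_inter (hJ : IsSpectator J) (t c x : Bool) :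
    (withGhosts J t c x ∩ {.theta, .cDag, .xi}).card = t.toNat + c.toNat + x.toNat := by
  have : withGhosts J t c x ∩ {.theta, .cDag, .xi} = withGhosts ∅ t c x := by
    ext g
    obtain ⟨h1, h2, h3⟩ := hJ
    rw [Finset.mem_inter, mem_withGhosts, mem_withGhosts]
    cases g <;> simp [h1, h2, h3]
  rw [this]
  cases t <;> cases c <;> cases x <;> rfl

theorem ghostMul_theta_apply (hJ : IsSpectator J) (Φ : ParentSpace d) (t c x : Bool) :
    ghostMul .theta Φ (withGhosts J t c x) = if t then Φ (withGhosts J false c x) else 0 := by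
  simp only [ghostMul, LinearMap.coe_mk, AddHom.coe_mk, theta_mem_withGhosts hJ,
    erase_theta_withGhosts hJ]
  simp [Ghost.rank]

theorem ghostMul_cDag_apply (hJ : IsSpectator J) (Φ : ParentSpace d) (t c x : Bool) :
    ghostMul .cDag Φ (withGhosts J t c x) =
      if c then ghostSign t • Φ (withGhosts J t false x) else 0 := by
  simp only [ghostMul, LinearMap.coe_mk, AddHom.coe_mk, cDag_mem_withGhosts hJ,
    erase_cDag_withGhosts hJ]
  have : (withGhosts J t c x).filter (fun h => h.rank < Ghost.rank (d := d) .cDag) =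
      if t then {.theta} else ∅ := by
    ext g
    rw [Finset.mem_filter, mem_withGhosts]
    cases t <;> cases g <;> simp [hJ.1, Ghost.rank]
  rw [this]
  cases t <;> simp [ghostSign]

theorem ghostMul_xi_apply (hJ : IsSpectator J) (Φ : ParentSpace d) (t c x : Bool) :
    ghostMul .xi Φ (withGhosts J t c x) =
      if x then (ghostSign t * ghostSign c) • Φ (withGhosts J t c false) else 0 := by
  simp only [ghostMul, LinearMap.coe_mk, AddHom.coe_mk, xi_mem_withGhosts hJ,
    erase_xi_withGhosts hJ]
  have : (withGhosts J t c x).filter (fun h => h.rank < Ghost.rank (d := d) .xi) =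
      withGhosts ∅ t c false := by
    ext g
    rw [Finset.mem_filter, mem_withGhosts, mem_withGhosts]
    cases g <;> simp [hJ.1, hJ.2.1, Ghost.rank]
    omega
  have hcard : (withGhosts (∅ : Finset (Ghost d)) t c false).card = t.toNat + c.toNat := by
    cases t <;> cases c <;> rfl
  rw [this, hcard]
  cases t <;> cases c <;> simp [ghostSign]

/-- The components of `Φ` along the ghost monomials whose part outside `θ`, `c†`, `ξ` is `J`. -/
def components (J : Finset (Ghost d)) (Φ : ParentSpace d) (t c x : Bool) : Coeff d :=
  Φ (withGhosts J t c x)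

theorem ext_components {Φ Ψ : ParentSpace d}
    (h : ∀ J, IsSpectator J → components J Φ = components J Ψ) : Φ = Ψ := by
  funext I
  obtain ⟨J, t, c, x, hJ, rfl⟩ := exists_eq_withGhosts I
  exact congrFun (congrFun (congrFun (h J hJ) t) c) x

theorem mem_homogeneous_iff {i : ℕ} {Φ : ParentSpace d} :
    Φ ∈ homogeneous d i ↔ ∀ J, IsSpectator J → IsGhostHomogeneous i (components J Φ) := by
  constructor
  · intro h J hJ t c x hi
    exact h _ (by rwa [card_withGhosts_inter hJ])
  · intro h I hI
    obtain ⟨J, t, c, x, hJ, rfl⟩ := exists_eq_withGhosts I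
    exact h J hJ t c x (by rwa [card_withGhosts_inter hJ] at hI)

theorem exists_components_eq (G : Finset (Ghost d) → Bool → Bool → Bool → Coeff d) :
    ∃ Φ : ParentSpace d, ∀ J, IsSpectator J → components J Φ = G J := by
  refine ⟨fun I => G (spectators I) (decide (.theta ∈ I)) (decide (.cDag ∈ I)) (decide (.xi ∈ I)),
    fun J hJ => ?_⟩
  funext t c x
  simp [components, spectators_withGhosts hJ, theta_mem_withGhosts hJ, cDag_mem_withGhosts hJ,
    xi_mem_withGhosts hJ]

/-- On components `Ω` is the Koszul differential of the operators `-□`, `-iS`, `T`. -/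
abbrev koszulOmega (η : Matrix (Fin d) (Fin d) ℝ) :=
  koszul (-boxCoeff η) (-Complex.I • sCoeff η) (tCoeff η)

theorem components_omega (η : Matrix (Fin d) (Fin d) ℝ) (hJ : IsSpectator J) (Φ : ParentSpace d) :
    components J (omega η Φ) = koszulOmega η (components J Φ) := by
  funext t c x
  simp only [components, omega, LinearMap.smul_apply, LinearMap.add_apply, LinearMap.neg_apply,
    LinearMap.comp_apply, Pi.smul_apply, Pi.add_apply, Pi.neg_apply, ghostMul_theta_apply hJ,
    ghostMul_cDag_apply hJ, ghostMul_xi_apply hJ, koszulOmega, koszul]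
  change -Complex.I • (-(Complex.I • (if t then boxCoeff η (Φ _) else 0)) +
    (if c then ghostSign t • sCoeff η (Φ _) else 0) +
    Complex.I • (if x then (ghostSign t * ghostSign c) • tCoeff η (Φ _) else 0)) = _
  rw [smul_add, smul_add, smul_neg, smul_smul, smul_smul]
  simp only [neg_mul, Complex.I_mul_I, neg_neg, one_smul, smul_ite, smul_zero]
  congr 2
  · split_ifs <;> simp
  · split_ifs
    · rw [smul_comm]
    · rfl

end Components

/-! ### Cohomology of `Ω` -/

section Cohomology

variable {d : ℕ} {η : Matrix (Fin d) (Fin d) ℝ}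

theorem mem_coboundaries_of_components {i : ℕ} {Φ : ParentSpace d}
    (h : ∀ J, IsSpectator J →
      ∃ G, IsGhostHomogeneous i G ∧ koszulOmega η G = components J Φ) :
    Φ ∈ coboundaries η (i + 1) := by
  choose! G hG hG' using h
  obtain ⟨Ψ, hΨ⟩ := exists_components_eq G
  refine ⟨Ψ, mem_homogeneous_iff.2 fun J hJ => (hΨ J hJ).symm ▸ hG J hJ, ?_⟩
  refine ext_components fun J hJ => ?_
  rw [components_omega η hJ, hΨ J hJ, hG' J hJ]

theorem subsingleton_cohomology_iff {i : ℕ} :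
    Subsingleton (Cohomology η i) ↔ cocycles η i ≤ coboundaries η i := by
  rw [Submodule.Quotient.subsingleton_iff, Submodule.submoduleOf_eq_top]

theorem koszulOmega_components_eq_zero {i : ℕ} {Φ : ParentSpace d} (hΦ : Φ ∈ cocycles η i)
    {J : Finset (Ghost d)} (hJ : IsSpectator J) : koszulOmega η (components J Φ) = 0 := by
  rw [← components_omega η hJ, LinearMap.mem_ker.1 hΦ.2]
  rfl

theorem neg_boxCoeff_surjective (hη : η.IsSymm) (h0 : η ≠ 0) :
    Function.Surjective (-boxCoeff η) := fun f => by
  obtain ⟨g, hg⟩ := boxCoeff_surjective hη h0 (-f)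
  exact ⟨g, by rw [LinearMap.neg_apply, hg, neg_neg]⟩

theorem subsingleton_cohomology_of_two_le (hη : η.IsSymm) (h0 : η ≠ 0) {i : ℕ} (hi : 2 ≤ i) :
    Subsingleton (Cohomology η i) := by
  rw [subsingleton_cohomology_iff]
  intro Φ hΦ
  have hhom := mem_homogeneous_iff.1 hΦ.1
  obtain ⟨i, rfl⟩ := Nat.exists_eq_add_of_le' hi
  refine mem_coboundaries_of_components fun J hJ => ?_
  match i with
  | 0 =>
    refine koszul_exact_two (neg_boxCoeff_surjective hη h0) ?_ ?_ ?_ (hhom J hJ)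
      (koszulOmega_components_eq_zero hΦ hJ)
    · intro f
      simp [sCoeff_boxCoeff]
    · intro f
      simp [tCoeff_boxCoeff]
    · intro f hf
      obtain ⟨f', h, h'⟩ := exists_tCoeff_eq hη h0 f (by simpa using hf)
      exact ⟨f', by simpa using h, h'⟩
  | 1 => exact koszul_exact_three (neg_boxCoeff_surjective hη h0) (hhom J hJ)
  | i + 2 =>
    refine ⟨0, fun _ _ _ _ => rfl, ?_⟩
    funext t c x
    rw [hhom J hJ t c x]
    · simp [koszulOmega, koszul]
    · have := t.toNat_le
      have := c.toNat_le
      have := x.toNat_le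
      omega

theorem subsingleton_cohomology_one (hd : 3 ≤ d) (hη : η.IsSymm) (hdet : IsUnit η.det)
    (h0 : η ≠ 0) : Subsingleton (Cohomology η 1) := by
  rw [subsingleton_cohomology_iff]
  intro Φ hΦ
  refine mem_coboundaries_of_components fun J hJ => ?_
  refine koszul_exact_one (neg_boxCoeff_surjective hη h0) ?_ ?_ ?_ ?_ ?_
    (mem_homogeneous_iff.1 hΦ.1 J hJ) (koszulOmega_components_eq_zero hΦ hJ)
  · intro f
    simp [sCoeff_boxCoeff]
  · intro f
    simp [tCoeff_boxCoeff]
  · intro f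
    simp [sCoeff_tCoeff]
  · intro f hf
    obtain ⟨f', h, h'⟩ := exists_tCoeff_eq hη h0 f (by simpa using hf)
    exact ⟨f', by simpa using h, h'⟩
  · intro f hf hf'
    obtain ⟨f', h, h', h''⟩ := exists_sCoeff_eq hd hη hdet (Complex.I • f)
      (by simpa using hf) (by simpa using hf')
    refine ⟨f', by simpa using h, h', ?_⟩
    rw [LinearMap.smul_apply, h'', smul_smul]
    simp

theorem hatE_eq_cocycles : hatE η = cocycles η 0 := by
  ext Φ
  constructor
  · rintro ⟨⟨⟨h, hb⟩, hs⟩, ht⟩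
    refine ⟨h, ?_⟩
    have hb : box η Φ = 0 := hb
    have hs : opS η Φ = 0 := hs
    have ht : opT η Φ = 0 := ht
    change omega η Φ = 0
    simp [omega, hb, hs, ht]
  · intro hΦ
    have hD := fun J (hJ : IsSpectator J) => koszulOmega_components_eq_zero hΦ hJ
    have hhom := mem_homogeneous_iff.1 hΦ.1
    -- a component without `θ`, `c†`, `ξ` is annihilated by the operators, the others vanish
    have key : ∀ P : Coeff d →ₗ[ℂ] Coeff d,
        (∀ J, IsSpectator J → P (components J Φ false false false) = 0) →
        P.compLeft (Finset (Ghost d)) Φ = 0 := by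
      intro P hP
      refine ext_components fun J hJ => ?_
      funext t c x
      change P (components J Φ t c x) = 0
      by_cases h : t.toNat + c.toNat + x.toNat = 0
      · have := hP J hJ
        cases t <;> cases c <;> cases x <;> simp at h
        exact this
      · rw [hhom J hJ t c x h, map_zero]
    refine ⟨⟨⟨hΦ.1, key (boxCoeff η) fun J hJ => ?_⟩, key (sCoeff η) fun J hJ => ?_⟩,
      key (tCoeff η) fun J hJ => ?_⟩
    · simpa [koszulOmega, koszul] using congrFun (congrFun (congrFun (hD J hJ) true) false) false
    · simpa [koszulOmega, koszul, ghostSign] using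
        congrFun (congrFun (congrFun (hD J hJ) false) true) false
    · simpa [koszulOmega, koszul, ghostSign] using
        congrFun (congrFun (congrFun (hD J hJ) false) false) true

/-- The isomorphism from `Ê` onto the cohomology in degree `0`. -/
def hatEEquiv (η : Matrix (Fin d) (Fin d) ℝ) : hatE η ≃ₗ[ℂ] Cohomology η 0 :=
  (LinearEquiv.ofEq _ _ hatE_eq_cocycles).trans
    (Submodule.quotEquivOfEqBot _ (by simp [coboundaries, Submodule.submoduleOf])).symm

theorem nontrivial_cohomology_zero : Nontrivial (Cohomology η 0) := by
  have h1 : ∀ P : Coeff d →ₗ[ℂ] Coeff d, P 1 = 0 →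
      P.compLeft (Finset (Ghost d)) (Pi.single ∅ 1) = 0 := by
    intro P hP
    funext I
    by_cases hI : I = ∅
    · subst hI
      simpa using hP
    · simp [hI]
  have hA : ∀ μ : Fin d, dA μ (1 : Coeff d) = 0 := fun μ => by simp [dA]
  have hY : ∀ μ : Fin d, dY μ (1 : Coeff d) = 0 := fun μ => by
    ext n : 1
    rw [coeff_dY, MvPolynomial.coeff_one]
    split_ifs <;> simp
  have hmem : (Pi.single ∅ 1 : ParentSpace d) ∈ hatE η := by
    refine ⟨⟨⟨?_, h1 (boxCoeff η) ?_⟩, h1 (sCoeff η) ?_⟩, h1 (tCoeff η) ?_⟩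
    · intro I hI
      refine Pi.single_eq_of_ne (fun h => hI ?_) _
      simp [h]
    · simp only [boxCoeff, LinearMap.sum_apply, LinearMap.smul_apply, LinearMap.comp_apply,
        hY, map_zero, smul_zero, Finset.sum_const_zero]
    · simp only [sCoeff, LinearMap.sum_apply, LinearMap.smul_apply, LinearMap.comp_apply,
        hY, map_zero, smul_zero, Finset.sum_const_zero]
    · simp only [tCoeff, LinearMap.sum_apply, LinearMap.smul_apply, LinearMap.comp_apply,
        hA, map_zero, smul_zero, Finset.sum_const_zero]
  have hne : (⟨_, hmem⟩ : hatE η) ≠ 0 := fun h => by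
    simpa using congrFun (congrArg Subtype.val h) ∅
  have : Nontrivial (hatE η) := ⟨_, _, hne⟩
  exact (hatEEquiv η).symm.toEquiv.nontrivial

end Cohomology

/-! ### Degree one in dimensions one and two -/

section LowDimension

open MvPolynomial

variable {d : ℕ} {η : Matrix (Fin d) (Fin d) ℝ}

/-- In dimensions `1` and `2` the quadratic form `η` is a product of two linear forms. -/
theorem exists_linear_factors (hd : d = 1 ∨ d = 2) (hη : η.IsSymm) :
    ∃ k w : Fin d → ℂ, k ≠ 0 ∧ ∀ μ ν, (η μ ν : ℂ) = k μ * w ν + w μ * k ν := by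
  rcases hd with rfl | rfl
  · refine ⟨fun _ => 1, fun _ => η 0 0 / 2, fun h => one_ne_zero (congrFun h 0), fun μ ν => ?_⟩
    rw [Subsingleton.elim μ 0, Subsingleton.elim ν 0]
    ring
  · have h10 : η 1 0 = η 0 1 := hη.apply 0 1
    by_cases ha : η 0 0 = 0
    · refine ⟨![0, 1], ![η 0 1, η 1 1 / 2], fun h => by simpa using congrFun h 1, ?_⟩
      intro μ ν
      fin_cases μ <;> fin_cases ν <;> simp [ha, h10]
    · obtain ⟨s, hs⟩ := IsAlgClosed.exists_eq_mul_self ((η 0 1 : ℂ) ^ 2 - η 0 0 * η 1 1)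
      have ha' : (η 0 0 : ℂ) ≠ 0 := by exact_mod_cast ha
      refine ⟨![1, (η 0 1 - s) / η 0 0], ![η 0 0 / 2, (η 0 1 + s) / 2],
        fun h => by simpa using congrFun h 0, ?_⟩
      intro μ ν
      fin_cases μ <;> fin_cases ν <;> simp [h10] <;> field_simp
      · ring
      · ring
      · linear_combination -2 * hs

/-- If `η` is a product of two linear forms, then the product of the symbols of the first one
kills the symbol of `S` modulo those of `□` and `T`. -/
theorem sSymbol_mul_linear_mem {k w : Fin d → ℂ}
    (h : ∀ μ ν, (η μ ν : ℂ) = k μ * w ν + w μ * k ν) :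
    sSymbol (complexMetric η) * ((∑ μ, k μ • X μ) * ∑ μ, k μ • C (X μ)) ∈
      Ideal.span {boxSymbol (complexMetric η), tSymbol (complexMetric η)} := by
  have hprod : ∀ a b : Fin d → SymbolRing d, ∑ μ, ∑ ν, complexMetric η μ ν • (a μ * b ν) =
      (∑ μ, k μ • a μ) * (∑ μ, w μ • b μ) + (∑ μ, w μ • a μ) * (∑ μ, k μ • b μ) := by
    intro a b
    simp only [Finset.sum_mul_sum, smul_mul_smul_comm, ← Finset.sum_add_distrib, ← add_smul,
      Matrix.map_apply, h]
  rw [boxSymbol, sSymbol, tSymbol, hprod, hprod, hprod, Ideal.mem_span_pair]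
  set ka : SymbolRing d := ∑ μ, k μ • X μ
  set kp : SymbolRing d := ∑ μ, k μ • C (X μ)
  set wa : SymbolRing d := ∑ μ, w μ • X μ
  set wp : SymbolRing d := ∑ μ, w μ • C (X μ)
  have h2 : algebraMap ℂ (SymbolRing d) 2⁻¹ * 2 = 1 := by
    rw [← map_ofNat (algebraMap ℂ (SymbolRing d)) 2, ← map_mul, inv_mul_cancel₀ two_ne_zero,
      map_one]
  -- the symbols of `□` and `T` are `2 kp wp` and `2 ka wa`, that of `S` is `ka wp + wa kp`
  refine ⟨algebraMap ℂ (SymbolRing d) 2⁻¹ * (ka * ka), algebraMap ℂ (SymbolRing d) 2⁻¹ * (kp * kp),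
    ?_⟩
  linear_combination (ka * ka * kp * wp + kp * kp * ka * wa) * h2

theorem expFactorial_single_one (μ : Fin d) : expFactorial (Finsupp.single μ 1) = 1 := by
  have := expFactorial_add_single 0 μ
  simpa [expFactorial] using this

/-- In dimensions `1` and `2` there is a common solution of `□ f = 0` and `T f = 0`, namely
`y^μ a†^μ` for a suitable `μ`, that is not `S` of another one. -/
theorem exists_forall_sCoeff_ne (hd : d = 1 ∨ d = 2) (hη : η.IsSymm) :
    ∃ f : Coeff d, boxCoeff η f = 0 ∧ tCoeff η f = 0 ∧
      ∀ f', boxCoeff η f' = 0 → tCoeff η f' = 0 → sCoeff η f' ≠ f := by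
  obtain ⟨k, w, hk, hkw⟩ := exists_linear_factors hd hη
  obtain ⟨μ, hμ⟩ := Function.ne_iff.1 hk
  -- the index `μ` is chosen so that `k(α) k(p)` pairs with `y^μ a†^μ` to `k_μ ^ 2 ≠ 0`
  refine ⟨monomial (Finsupp.single μ 1) (MvPowerSeries.X μ), ?_, ?_, fun f' hb ht hs => ?_⟩
  · have : ∀ a b : Fin d,
        dY a (dY b (monomial (Finsupp.single μ 1) (MvPowerSeries.X μ) : Coeff d)) = 0 := by
      intro a b
      ext n : 1
      rw [coeff_dY, coeff_dY, coeff_monomial, coeff_zero]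
      split_ifs
      · rw [MvPowerSeries.pderiv_X, Pi.single_apply]
        split_ifs <;> simp
      · simp
    simp only [boxCoeff, LinearMap.sum_apply, LinearMap.smul_apply, LinearMap.comp_apply,
      this, smul_zero, Finset.sum_const_zero]
  · have : ∀ a b : Fin d,
        dA a (dA b (monomial (Finsupp.single μ 1) (MvPowerSeries.X μ) : Coeff d)) = 0 := by
      intro a b
      ext n : 1
      rw [coeff_dA, coeff_dA, coeff_monomial, if_neg, zero_mul, zero_mul, coeff_zero]
      intro h
      have := congrArg Finsupp.degree h
      simp at this
    simp only [tCoeff, LinearMap.sum_apply, LinearMap.smul_apply, LinearMap.comp_apply,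
      this, smul_zero, Finset.sum_const_zero]
  · rw [eq_zero_iff_pairing (pairing_boxCoeff η)] at hb
    rw [eq_zero_iff_pairing (pairing_tCoeff η)] at ht
    have hx := (eq_iff_pairing (pairing_sCoeff η) _ _).1 hs
      ((∑ μ, k μ • X μ) * ∑ μ, k μ • C (X μ))
    obtain ⟨a, b, hab⟩ := Ideal.mem_span_pair.1 (sSymbol_mul_linear_mem hkw)
    rw [← hab, map_add, mul_comm a, mul_comm b, hb, ht, add_zero] at hx
    have hXX : ∀ a b : Fin d, (X a * C (X b) : SymbolRing d) =
        symbolBasis d (Finsupp.single b 1, Finsupp.single a 1) := by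
      intro a b
      rw [symbolBasis_apply, mul_comm]
      exact (C_mul_monomial (s := Finsupp.single a 1) (a := X b) (a' := 1)).trans
        (by rw [mul_one]; rfl)
    have : ∀ a b : Fin d, pairing d (monomial (Finsupp.single μ 1) (MvPowerSeries.X μ))
        (X a * C (X b)) = if a = μ then if b = μ then 1 else 0 else 0 := by
      intro a b
      rw [hXX, pairing_symbolBasis, coeff_monomial]
      simp only [Finsupp.single_left_inj one_ne_zero, expFactorial_single_one, eq_comm (a := μ)]
      split_ifs <;> simp_all [MvPowerSeries.coeff_X, Finsupp.single_left_inj one_ne_zero]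
    rw [Finset.sum_mul_sum] at hx
    simp only [smul_mul_smul_comm, map_sum, map_smul, this] at hx
    simp at hx
    exact hμ hx

theorem nontrivial_cohomology_one (hd : d = 1 ∨ d = 2) (hη : η.IsSymm) :
    Nontrivial (Cohomology η 1) := by
  rw [← not_subsingleton_iff_nontrivial, subsingleton_cohomology_iff]
  obtain ⟨f, hb, ht, hf⟩ := exists_forall_sCoeff_ne hd hη
  intro hle
  obtain ⟨Φ, hΦ⟩ := exists_components_eq (d := d) fun J t c x =>
    if J = ∅ ∧ t = false ∧ c = true ∧ x = false then f else 0
  have hΦ1 : Φ ∈ cocycles η 1 := by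
    refine ⟨mem_homogeneous_iff.2 fun J hJ => ?_, ?_⟩
    · intro t c x h
      rw [hΦ J hJ]
      cases t <;> cases c <;> cases x <;> simp at h ⊢
    · refine LinearMap.mem_ker.2 (ext_components fun J hJ => ?_)
      rw [components_omega η hJ, hΦ J hJ]
      funext t c x
      change _ = 0
      by_cases hJ0 : J = ∅
      · cases t <;> cases c <;> cases x <;> simp [koszulOmega, koszul, hJ0, hb, ht]
      · simp [koszulOmega, koszul, hJ0]
  obtain ⟨Ψ, -, hΨ⟩ := hle hΦ1
  have hJ : IsSpectator (∅ : Finset (Ghost d)) := by simp [IsSpectator]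
  have hD := components_omega η hJ Ψ
  rw [hΨ, hΦ _ hJ] at hD
  refine hf (-Complex.I • components ∅ Ψ false false false) ?_ ?_ ?_
  · have := congrFun (congrFun (congrFun hD true) false) false
    rw [map_smul]
    simpa [koszulOmega, koszul] using this
  · have := congrFun (congrFun (congrFun hD false) false) true
    rw [map_smul]
    simpa [koszulOmega, koszul, ghostSign] using this.symm
  · have := congrFun (congrFun (congrFun hD false) true) false
    rw [map_smul]
    simpa [koszulOmega, koszul, ghostSign] using this.symm

end LowDimension

end Fronsdal

end

theorem lemma4p1 (d : ℕ) (η : Matrix (Fin d) (Fin d) ℝ) (hsymm : η.IsSymm)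
    (hdet : IsUnit η.det) :
    ((d = 1 ∨ d = 2) →
      Nontrivial (Fronsdal.Cohomology η 0) ∧ Nontrivial (Fronsdal.Cohomology η 1) ∧
        ∀ i : ℕ, 2 ≤ i → Subsingleton (Fronsdal.Cohomology η i)) ∧
    (3 ≤ d →
      Nontrivial (Fronsdal.Cohomology η 0) ∧
        ∀ i : ℕ, 1 ≤ i → Subsingleton (Fronsdal.Cohomology η i)) ∧
    (1 ≤ d →
      ∃ e : Fronsdal.hatE η ≃ₗ[ℂ] Fronsdal.Cohomology η 0,
        ∀ Φ : Fronsdal.hatE η, ∃ hΦ : (Φ : Fronsdal.ParentSpace d) ∈ Fronsdal.cocycles η 0,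
          e Φ = Submodule.Quotient.mk ⟨Φ, hΦ⟩) := by
  have hne : 1 ≤ d → η ≠ 0 := by
    rintro hd rfl
    have : Nonempty (Fin d) := ⟨⟨0, hd⟩⟩
    simp at hdet
  refine ⟨fun hd => ⟨Fronsdal.nontrivial_cohomology_zero,
    Fronsdal.nontrivial_cohomology_one hd hsymm, fun i hi =>
      Fronsdal.subsingleton_cohomology_of_two_le hsymm (hne (by omega)) hi⟩,
    fun hd => ⟨Fronsdal.nontrivial_cohomology_zero, fun i hi => ?_⟩,
    fun _ => ⟨Fronsdal.hatEEquiv η, fun Φ => ⟨Fronsdal.hatE_eq_cocycles ▸ Φ.2, rfl⟩⟩⟩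
  rcases hi.eq_or_lt with rfl | hi
  · exact Fronsdal.subsingleton_cohomology_one hd hsymm hdet (hne (by omega))
  · exact Fronsdal.subsingleton_cohomology_of_two_le hsymm (hne (by omega)) hi
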